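/- Let $H$ be a set of functions $g:\mathbb R\to\mathbb R$ with period $1$ such that $\theta_c g:=g(\cdot+c)\in H$ for all $g\in H$, $c\in\mathbb R$, equipped with its cylindrical $\sigma$-field, and let $\mathcal I$ be the set of compact intervals $[a,b]$ with $a<b$. An *intrinsic location functional* is a map $L:H\times\mathcal I\to\mathbb R\cup\{\infty\}$ such that, for all $g\in H$, $c\in\mathbb R$ and $I,I_1,I_2\in\mathcal I$ with $I_2\subseteq I_1$: $L(\cdot,I)$ is measurable; $L(g,I)\in I\cup\{\infty\}$; $L(g,I)=L(\theta_cg,I-c)+c$ (with $\infty+c=\infty$); if $L(g,I_1)\in I_2$ then $L(g,I_2)=L(g,I_1)$; if $L(g,I_2)\ne\infty$ then $L(g,I_1)\neq\infty$. Let $\mathbf X=\{X(t),t\in\mathbb R\}$ be a stationary process with continuous sample paths belonging to $H$ (in particular with period $1$) which is ergodic, i.e. every measurable function on the path space $\mathbb R^{\mathbb R}$ (with the cylindrical $\sigma$-field) that is almost surely $\theta_t$-invariant for each $t\in\mathbb R$ is almost surely constant under the law of $\mathbf X$. Let $L$ be an intrinsic location functional on $H$, let $0<T\le 1$, and let $F$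 be the law of $L(\mathbf X,[0,T])$ on $[0,T]\cup\{\infty\}$. Say that $h:(0,T)\to\mathbb R$ satisfies condition (TV) if for all $0<t_1<t_2<T$ $$\mathrm{TV}_{(t_1,t_2)}(h)\le h(t_1)+h(t_2),\qquad \mathrm{TV}_{(t_1,t_2)}(h)=\sup_{n\ge1,\;t_1<s_1<\dots<s_n<t_2}\ \sum_{i=1}^{n-1}|h(s_{i+1})-h(s_i)|.$$ Then the restriction of $F$ to $(0,T)$ is absolutely continuous and has a càdlàg density on $(0,T)$; and its càdlàg density $f$ satisfies: 1. $f(t)$ is a non-negative integer for every $t\in(0,T)$; 2. $f$ satisfies condition (TV); 3. if $F([0,T])>0$ and there is no $t\in(0,T)$ with $F([0,t])=1$ or $F([t,T])=1$, then $f(t)\ge1$ for all $t\in(0,T)$; if furthermore $F(\{\infty\})>0$, then $f-1$ also satisfies condition (TV). -/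

import Mathlib

open MeasureTheory Set Filter Topology

/-- The shift `θ_c g (x) = g (x + c)` of a path. -/
def pathShift (c : ℝ) (g : ℝ → ℝ) : ℝ → ℝ := fun x => g (x + c)

/-- A set `H` of real functions on `ℝ` with period `1` that is invariant under all shifts.
Its elements form a subtype of `ℝ → ℝ`, which carries the cylindrical `σ`-field (the trace of the
product `σ`-field on `ℝ → ℝ`). -/
structure PathClass where
  carrier : Set (ℝ → ℝ)
  periodic : ∀ g ∈ carrier, Function.Periodic g 1
  shift_mem : ∀ g ∈ carrier, ∀ c : ℝ, pathShift c g ∈ carrier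

/-- The shift as a map from `H` to itself. -/
def PathClass.shift (H : PathClass) (c : ℝ) (g : H.carrier) : H.carrier :=
  ⟨pathShift c g, H.shift_mem g g.2 c⟩

/-- `L` is an intrinsic location functional on `H`. Here `L g a b` is the value of `L` at the path
`g` and the compact non-degenerate interval `[a, b]`, `a < b`; values for `b ≤ a` play no role.
The range `ℝ ∪ {∞}` is `WithTop ℝ`, whose `σ`-field is generated by the Borel subsets
of `ℝ` and the separate point `∞ = ⊤`; in it `⊤ + c = ⊤`. -/
structure IsIntrinsicLocation (H : PathClass) (L : H.carrier → ℝ → ℝ → WithTop ℝ) : Prop where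
  measurable : ∀ a b : ℝ, a < b → Measurable fun g : H.carrier => L g a b
  mem_interval : ∀ (g : H.carrier) (a b : ℝ), a < b →
    L g a b = ⊤ ∨ ∃ x ∈ Icc a b, L g a b = (x : WithTop ℝ)
  shift_compatible : ∀ (g : H.carrier) (a b c : ℝ), a < b →
    L g a b = L (H.shift c g) (a - c) (b - c) + (c : WithTop ℝ)
  stable : ∀ (g : H.carrier) (a₁ b₁ a₂ b₂ : ℝ), a₂ < b₂ → Icc a₂ b₂ ⊆ Icc a₁ b₁ →
    (∃ x ∈ Icc a₂ b₂, L g a₁ b₁ = (x : WithTop ℝ)) → L g a₂ b₂ = L g a₁ b₁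
  consistent : ∀ (g : H.carrier) (a₁ b₁ a₂ b₂ : ℝ), a₂ < b₂ → Icc a₂ b₂ ⊆ Icc a₁ b₁ →
    L g a₂ b₂ ≠ ⊤ → L g a₁ b₁ ≠ ⊤

/-- The law on the path space `ℝ → ℝ`, with the cylindrical `σ`-field, of the process `X`. -/
noncomputable def processLaw {Ω : Type*} [MeasurableSpace Ω] (P : Measure Ω) (X : ℝ → Ω → ℝ) :
    Measure (ℝ → ℝ) :=
  P.map fun ω t => X t ω

/-- `X` is a stationary process: its law on path space is invariant under all shifts. -/
def IsStationaryProcess {Ω : Type*} [MeasurableSpace Ω] (P : Measure Ω) (X : ℝ → Ω → ℝ) : Prop :=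
  (∀ t, Measurable (X t)) ∧ ∀ c : ℝ, (processLaw P X).map (pathShift c) = processLaw P X

/-- `X` is an ergodic process: it is stationary, and every measurable function on path space that
is `θ_t`-invariant (almost surely) for every `t` is almost surely constant. -/
def IsErgodicProcess {Ω : Type*} [MeasurableSpace Ω] (P : Measure Ω) (X : ℝ → Ω → ℝ) : Prop :=
  IsStationaryProcess P X ∧
    ∀ φ : (ℝ → ℝ) → ℝ, Measurable φ →
      (∀ t : ℝ, ∀ᵐ w ∂(processLaw P X), φ (pathShift t w) = φ w) →
      ∃ c : ℝ, ∀ᵐ w ∂(processLaw P X), φ w = c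

/-- The law on `ℝ ∪ {∞}` of `L(X, [0, T])`, where the paths of `X` belong to `H`. -/
noncomputable def locationLaw {Ω : Type*} [MeasurableSpace Ω] (P : Measure Ω) (X : ℝ → Ω → ℝ)
    (H : PathClass) (hX : ∀ ω, (fun t => X t ω) ∈ H.carrier)
    (L : H.carrier → ℝ → ℝ → WithTop ℝ) (T : ℝ) : Measure (WithTop ℝ) :=
  P.map fun ω => L ⟨fun t => X t ω, hX ω⟩ 0 T

/-- A Borel subset of `ℝ` seen as a subset of `ℝ ∪ {∞}`. -/
def finitePart (B : Set ℝ) : Set (WithTop ℝ) := (fun x : ℝ => (x : WithTop ℝ)) '' B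

/-- `f` is a càdlàg density on `(0, T)` of the measure `F` on `ℝ ∪ {∞}`: the restriction of `F`
to `(0, T)` is absolutely continuous with density `f`, and `f` is right-continuous with left limits
at every point of `(0, T)`. The values of `f` outside `(0, T)` play no role. -/
structure IsCadlagDensity (F : Measure (WithTop ℝ)) (T : ℝ) (f : ℝ → ℝ) : Prop where
  integrableOn : IntegrableOn f (Ioo 0 T)
  density : ∀ B : Set ℝ, MeasurableSet B → B ⊆ Ioo 0 T →
    F.real (finitePart B) = ∫ x in B, f x
  right_continuous : ∀ t ∈ Ioo 0 T, ContinuousWithinAt f (Ici t) t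
  left_limit : ∀ t ∈ Ioo 0 T, ∃ l : ℝ, Tendsto f (𝓝[<] t) (𝓝 l)

/-- Condition (TV): for all `0 < t₁ < t₂ < T` the total variation of `f` on the open interval
`(t₁, t₂)` is finite and at most `f t₁ + f t₂`. -/
def VariationConstraint (T : ℝ) (f : ℝ → ℝ) : Prop :=
  ∀ t₁ t₂ : ℝ, 0 < t₁ → t₁ < t₂ → t₂ < T →
    BoundedVariationOn f (Ioo t₁ t₂) ∧ (eVariationOn f (Ioo t₁ t₂)).toReal ≤ f t₁ + f t₂

/-! Ergodicity makes the problem deterministic. As paths have period 1, the fraction of a period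
that the shifts of a path spend in a measurable set is shift-invariant, hence almost surely
constant, and by Fubini and stationarity the constant is the probability of the set. So for a single
path `g`, the finite part of the law is that of `L(g, [u, u + T]) - u` with `u` uniform on `[0, 1)`
(`exists_path_locationLaw_eq`).

Write `r u` for the location in the window `[u, u + T]`. The axioms make `r` nondecreasing, and two
values that lie in both windows are equal. As the window slides to the right, a point `x` that
serves as location appears at its highest relative position and drifts left at unit speed, so its
positions form an interval. The density at `t` counts the points of one period whose interval
contains `t` (`volume_relative_position`); it is integer-valued and locally a finite sum of
indicators of intervals `[a, b)`.

For the variation, let `G` be the number of intervals per period with upper end in `(s, t]`. The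
variation on `(s, t)` is at most `f t - f s + 2 * G`, so `G ≤ f s` suffices. Just before such a
point appears, the location is near the left end of the window, since otherwise old and new location
would coincide. As `r u - u` has no downward jumps, between two such appearances it passes down
through level `s`, and each passage is a point active at `s` (`exists_crossing`,
`exists_crossing_between`).

If the location is `∞` at `u₀`, it may be read as `u₀` or as `u₀ + T` without changing any position
inside `(0, T)`. Using both readings yields one extra crossing per period, which gives the bound for
`f - 1`. -/

/-! ### Ergodicity: from the process to a single path -/

/-- A version of the shift `u ↦ θ_u w` that is jointly measurable in `(w, u)`. -/
noncomputable def sampledShift (p : (ℝ → ℝ) × ℝ) : ℝ → ℝ := fun t =>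
  limsup (fun n : ℕ => p.1 ((⌊((n : ℝ) + 1) * (p.2 + t)⌋ : ℝ) / ((n : ℝ) + 1))) atTop

theorem measurable_sampledShift : Measurable sampledShift := by
  refine measurable_pi_iff.2 fun t => ?_
  refine Measurable.limsup fun n => ?_
  have h : Measurable fun q : ℤ × (ℝ → ℝ) => q.2 ((q.1 : ℝ) / ((n : ℝ) + 1)) :=
    measurable_from_prod_countable_right fun k => measurable_pi_apply ((k : ℝ) / ((n : ℝ) + 1))
  exact h.comp (((Int.measurable_floor.comp
    ((measurable_snd.add_const t).const_mul ((n : ℝ) + 1)))).prodMk measurable_fst)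

theorem tendsto_floor_mul_div (x : ℝ) :
    Tendsto (fun n : ℕ => (⌊((n : ℝ) + 1) * x⌋ : ℝ) / ((n : ℝ) + 1)) atTop (𝓝 x) := by
  have h1 : Tendsto (fun n : ℕ => x - 1 / ((n : ℝ) + 1)) atTop (𝓝 x) := by
    simpa using tendsto_const_nhds.sub tendsto_one_div_add_atTop_nhds_zero_nat (a := x)
  refine tendsto_of_tendsto_of_tendsto_of_le_of_le h1 tendsto_const_nhds (fun n => ?_) fun n => ?_
  · have hn : (0 : ℝ) < n + 1 := by positivity
    have := Int.sub_one_lt_floor (((n : ℝ) + 1) * x)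
    simp only
    rw [le_div_iff₀ hn, sub_mul, one_div, inv_mul_cancel₀ hn.ne']
    linarith
  · have hn : (0 : ℝ) < n + 1 := by positivity
    simp only
    rw [div_le_iff₀ hn, mul_comm x]
    exact Int.floor_le _

theorem sampledShift_of_continuous {w : ℝ → ℝ} (hw : Continuous w) (u : ℝ) :
    sampledShift (w, u) = pathShift u w := by
  funext t
  have := (hw.tendsto (u + t)).comp (tendsto_floor_mul_div (u + t))
  rw [pathShift, add_comm t u]
  exact this.limsup_eq

theorem measurable_pathShift (c : ℝ) : Measurable (pathShift c) :=
  measurable_pi_iff.2 fun _ => measurable_pi_apply _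

theorem pathShift_pathShift (a b : ℝ) (w : ℝ → ℝ) :
    pathShift a (pathShift b w) = pathShift (a + b) w := by
  funext x; simp [pathShift, add_assoc]

/-- The proportion of time that the shifts of a path spend in `A`. -/
noncomputable def occupation (A : Set (ℝ → ℝ)) (w : ℝ → ℝ) : ENNReal :=
  (volume.restrict (Ico (0 : ℝ) 1)) (Prod.mk w ⁻¹' (sampledShift ⁻¹' A))

theorem measurable_occupation {A : Set (ℝ → ℝ)} (hA : MeasurableSet A) :
    Measurable (occupation A) :=
  measurable_measure_prodMk_left (measurable_sampledShift hA)

theorem occupation_le_one (A : Set (ℝ → ℝ)) (w : ℝ → ℝ) : occupation A w ≤ 1 := by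
  refine (measure_mono (subset_univ _)).trans ?_
  simp

theorem occupation_eq {w : ℝ → ℝ} (hw : Continuous w) (A : Set (ℝ → ℝ)) :
    occupation A w = (volume.restrict (Ico (0 : ℝ) 1)) {u | pathShift u w ∈ A} := by
  unfold occupation
  congr 1
  ext u
  simp [sampledShift_of_continuous hw]

theorem measurableSet_pathShift_mem {w : ℝ → ℝ} (hw : Continuous w) {A : Set (ℝ → ℝ)}
    (hA : MeasurableSet A) : MeasurableSet {u | pathShift u w ∈ A} := by
  have := measurable_prodMk_left (x := w) (measurable_sampledShift hA)
  convert this using 1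
  ext u
  simp [sampledShift_of_continuous hw]

/-- Shifting by `c` replaces the period `[0, 1)` by `[c, c + 1)`; both are fundamental domains for
the integer translations, which preserve `E`. -/
theorem occupation_shift {w : ℝ → ℝ} (hw : Continuous w) (hp : Function.Periodic w 1)
    {A : Set (ℝ → ℝ)} (hA : MeasurableSet A) (c : ℝ) :
    occupation A (pathShift c w) = occupation A w := by
  have hc : Continuous (pathShift c w) := hw.comp (continuous_id.add continuous_const)
  rw [occupation_eq hc, occupation_eq hw]
  have hE := measurableSet_pathShift_mem hw hA
  set E : Set ℝ := {u | pathShift u w ∈ A} with hEdef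
  have h1 : {u | pathShift u (pathShift c w) ∈ A} = (fun u => u + c) ⁻¹' E := by
    ext u; simp [hEdef, pathShift_pathShift]
  have hper : ∀ g : AddSubgroup.zmultiples (1 : ℝ), (g +ᵥ · : ℝ → ℝ) ⁻¹' E = E := by
    rintro ⟨_, k, rfl⟩
    ext u
    have : pathShift (k + u) w = pathShift u w := by
      funext x
      have := (hp.int_mul k) (x + u)
      simp only [pathShift]
      rw [← this]; congr 1; ring
    simp [hEdef, AddSubgroup.vadd_def, this]
  have hdom (a : ℝ) := isAddFundamentalDomain_Ioc (zero_lt_one (α := ℝ)) a volume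
  rw [h1, Measure.restrict_apply ((measurable_add_const c) hE), Measure.restrict_apply hE]
  have h2 : (fun u => u + c) ⁻¹' E ∩ Ico (0 : ℝ) 1 =
      (fun u => u + c) ⁻¹' (E ∩ Ico c (c + 1)) := by
    ext u; simp [add_comm]
  rw [h2, measure_preimage_add_right]
  have h3 (a : ℝ) : volume (E ∩ Ico a (a + 1)) = volume (E ∩ Ioc a (a + 1)) :=
    measure_congr ((ae_eq_refl E).inter Ico_ae_eq_Ioc)
  rw [h3, (hdom c).measure_set_eq (hdom 0) hE hper]
  simpa using (h3 0).symm

section ErgodicProcess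

variable {Ω : Type*} [MeasurableSpace Ω] {P : Measure Ω} [IsProbabilityMeasure P]
  {X : ℝ → Ω → ℝ}

theorem lintegral_occupation (hcont : ∀ ω, Continuous fun t => X t ω)
    (hX : IsStationaryProcess P X) {A : Set (ℝ → ℝ)} (hA : MeasurableSet A) :
    ∫⁻ w, occupation A w ∂(processLaw P X) = processLaw P X A := by
  have hXm : Measurable fun ω t => X t ω := measurable_pi_iff.2 hX.1
  have : IsProbabilityMeasure (processLaw P X) := Measure.isProbabilityMeasure_map hXm.aemeasurable
  have hm := measurable_sampledShift hA
  unfold occupation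
  rw [← Measure.prod_apply hm, Measure.prod_apply_symm hm]
  have : ∀ u : ℝ, processLaw P X ((fun w => (w, u)) ⁻¹' (sampledShift ⁻¹' A)) =
      processLaw P X A := by
    intro u
    conv_rhs => rw [← hX.2 u, Measure.map_apply (measurable_pathShift u) hA]
    unfold processLaw
    rw [Measure.map_apply hXm (measurable_prodMk_right hm),
      Measure.map_apply hXm (measurable_pathShift u hA)]
    congr 1
    ext ω
    simp [sampledShift_of_continuous (hcont ω)]
  simp [this]

theorem ae_occupation_eq (hcont : ∀ ω, Continuous fun t => X t ω)
    (hper : ∀ ω, Function.Periodic (fun t => X t ω) 1)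
    (hX : IsErgodicProcess P X) {A : Set (ℝ → ℝ)} (hA : MeasurableSet A) :
    ∀ᵐ ω ∂P, occupation A (fun t => X t ω) = processLaw P X A := by
  have hXm : Measurable fun ω t => X t ω := measurable_pi_iff.2 hX.1.1
  have : IsProbabilityMeasure (processLaw P X) := Measure.isProbabilityMeasure_map hXm.aemeasurable
  have hm := measurable_occupation hA
  -- Invariance can fail at irregular `w`, so it is checked on `Ω`, where every path is continuous
  -- and periodic.
  obtain ⟨c, hc⟩ := hX.2 (fun w => (occupation A w).toReal) hm.ennreal_toReal fun t => by
    refine (ae_map_iff hXm.aemeasurable (measurableSet_eq_fun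
      (hm.ennreal_toReal.comp (measurable_pathShift t)) hm.ennreal_toReal)).2 (ae_of_all _ ?_)
    intro ω
    simp [occupation_shift (hcont ω) (hper ω) hA]
  have hc' : ∀ᵐ w ∂(processLaw P X), occupation A w = ENNReal.ofReal c := by
    filter_upwards [hc] with w hw
    rw [← hw, ENNReal.ofReal_toReal]
    exact ((occupation_le_one A w).trans_lt ENNReal.one_lt_top).ne
  have hF := lintegral_occupation hcont hX.1 hA
  rw [lintegral_congr_ae hc'] at hF
  simp only [lintegral_const, measure_univ, mul_one] at hF
  rw [← hF]
  exact ae_of_ae_map hXm.aemeasurable hc'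

theorem measurableEmbedding_withTop_coe : MeasurableEmbedding (fun x : ℝ => (x : WithTop ℝ)) where
  injective := WithTop.coe_injective
  measurable := WithTop.measurable_coe
  measurableSet_image' := by
    intro B hB
    have : (fun x : ℝ => (x : WithTop ℝ)) '' B =
        (WithTop.untopD (0 : ℝ)) ⁻¹' B ∩ {⊤}ᶜ := by
      ext y
      cases y <;> simp
    rw [this]
    exact (WithTop.measurable_untopD (0 : ℝ) hB).inter (measurableSet_singleton _).compl

theorem measurableSet_finitePart {B : Set ℝ} (hB : MeasurableSet B) :
    MeasurableSet (finitePart B) :=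
  measurableEmbedding_withTop_coe.measurableSet_image.2 hB

theorem IsIntrinsicLocation.mem_finitePart_iff {H : PathClass}
    {L : H.carrier → ℝ → ℝ → WithTop ℝ} (hL : IsIntrinsicLocation H L) {T : ℝ} (hT : 0 < T)
    (g : H.carrier) (u : ℝ) (B : Set ℝ) :
    L (H.shift u g) 0 T ∈ finitePart B ↔ ∃ x ∈ B, L g u (u + T) = ((u + x : ℝ) : WithTop ℝ) := by
  have h := hL.shift_compatible g u (u + T) u (by linarith)
  rw [sub_self, add_sub_cancel_left] at h
  rw [h]
  simp only [finitePart, mem_image]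
  refine exists_congr fun x => and_congr_right fun _ => ?_
  generalize L (H.shift u g) 0 T = y
  cases y with
  | top => exact iff_of_false WithTop.coe_ne_top WithTop.top_ne_coe
  | coe y =>
    rw [← WithTop.coe_add, WithTop.coe_inj, WithTop.coe_inj]
    constructor <;> intro h <;> linarith

theorem isProbabilityMeasure_locationLaw {H : PathClass}
    (hX : ∀ ω, (fun t => X t ω) ∈ H.carrier) (hXm : ∀ t, Measurable (X t))
    {L : H.carrier → ℝ → ℝ → WithTop ℝ} (hL : IsIntrinsicLocation H L) {T : ℝ} (hT : 0 < T) :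
    IsProbabilityMeasure (locationLaw P X H hX L T) :=
  Measure.isProbabilityMeasure_map
    ((hL.measurable 0 T hT).comp ((measurable_pi_iff.2 hXm).subtype_mk)).aemeasurable

theorem measurable_location {H : PathClass} {L : H.carrier → ℝ → ℝ → WithTop ℝ}
    (hL : IsIntrinsicLocation H L) {T : ℝ} (hT : 0 < T) {g : H.carrier} (hg : Continuous g.1) :
    Measurable fun u => L (H.shift u g) 0 T := by
  refine (hL.measurable 0 T hT).comp (Measurable.subtype_mk ?_)
  refine measurable_pi_iff.2 fun t => ?_
  exact (hg.comp (continuous_const.add continuous_id)).measurable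

/-- By ergodicity the law of the location is the distribution of the location along the shifts of
a single path. -/
theorem exists_path_locationLaw_eq {H : PathClass} (hX : ∀ ω, (fun t => X t ω) ∈ H.carrier)
    (hcont : ∀ ω, Continuous fun t => X t ω) (herg : IsErgodicProcess P X)
    {L : H.carrier → ℝ → ℝ → WithTop ℝ} (hL : IsIntrinsicLocation H L) {T : ℝ} (hT : 0 < T) :
    ∃ g : H.carrier, Continuous g.1 ∧ ∀ B : Set ℝ, MeasurableSet B →
      locationLaw P X H hX L T (finitePart B) =
        volume ({u | ∃ x ∈ B, L g u (u + T) = ((u + x : ℝ) : WithTop ℝ)} ∩ Ico 0 1) := by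
  have hXm : Measurable fun ω t => X t ω := measurable_pi_iff.2 herg.1.1
  have := isProbabilityMeasure_locationLaw (P := P) hX herg.1.1 hL hT
  have key (B : Set ℝ) (hB : MeasurableSet B) : ∀ᵐ ω ∂P,
      (volume.restrict (Ico (0 : ℝ) 1)).map (fun u => L (H.shift u ⟨_, hX ω⟩) 0 T) (finitePart B) =
        locationLaw P X H hX L T (finitePart B) := by
    obtain ⟨A, hA, hAB⟩ := hL.measurable 0 T hT (measurableSet_finitePart hB)
    filter_upwards [ae_occupation_eq hcont (fun ω => H.periodic _ (hX ω)) herg hA] with ω hω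
    rw [Measure.map_apply (measurable_location hL hT (hcont ω)) (measurableSet_finitePart hB)]
    rw [occupation_eq (hcont ω)] at hω
    have h1 (g : H.carrier) : g.1 ∈ A ↔ L g 0 T ∈ finitePart B := Set.ext_iff.1 hAB g
    calc _ = (volume.restrict (Ico (0 : ℝ) 1)) {u | pathShift u (fun t => X t ω) ∈ A} := by
          congr 1
          ext u
          exact (h1 (H.shift u ⟨_, hX ω⟩)).symm
      _ = _ := hω
      _ = _ := by
          have h2 : Measurable fun ω => L ⟨fun t => X t ω, hX ω⟩ 0 T :=
            (hL.measurable 0 T hT).comp hXm.subtype_mk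
          unfold processLaw locationLaw
          rw [Measure.map_apply hXm hA, Measure.map_apply h2 (measurableSet_finitePart hB)]
          congr 1
          ext ω'
          exact h1 ⟨_, hX ω'⟩
  -- The exceptional null set in `key` depends on `B`. Rational half-lines form a countable
  -- generating π-system, so one `ω` serves for all Borel sets.
  have hall := (ae_all_iff.2 fun q : ℚ => key (Iic (q : ℝ)) measurableSet_Iic).and
    (key univ MeasurableSet.univ)
  obtain ⟨ω, hω, hω'⟩ := hall.exists
  refine ⟨⟨_, hX ω⟩, hcont ω, fun B hB => ?_⟩
  have hm := measurable_location hL hT (g := ⟨_, hX ω⟩) (hcont ω)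
  set μ := (volume.restrict (Ico (0 : ℝ) 1)).map (fun u => L (H.shift u ⟨_, hX ω⟩) 0 T)
  have hμ : IsFiniteMeasure μ := inferInstance
  have hc (ν : Measure (WithTop ℝ)) (B : Set ℝ) :
      ν.comap (fun x : ℝ => (x : WithTop ℝ)) B = ν (finitePart B) :=
    measurableEmbedding_withTop_coe.comap_apply ν B
  have heq : (locationLaw P X H hX L T).comap (fun x : ℝ => (x : WithTop ℝ)) =
      μ.comap (fun x : ℝ => (x : WithTop ℝ)) := by
    have : IsFiniteMeasure ((locationLaw P X H hX L T).comap (fun x : ℝ => (x : WithTop ℝ))) :=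
      ⟨by rw [hc]; exact measure_lt_top _ _⟩
    refine ext_of_generate_finite _
      ((BorelSpace.measurable_eq (α := ℝ)).trans Real.borel_eq_generateFrom_Iic_rat)
      Real.isPiSystem_Iic_rat ?_ ?_
    · rintro s hs
      obtain ⟨q, rfl⟩ := mem_iUnion.1 hs
      rw [hc, hc, hω q]
    · rw [hc, hc, hω']
  rw [← hc, heq, hc, Measure.map_apply hm (measurableSet_finitePart hB), Measure.restrict_apply
    (hm (measurableSet_finitePart hB))]
  congr 2
  ext u
  exact hL.mem_finitePart_iff hT _ u B

end ErgodicProcess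

/-! ### The location in a sliding window -/

/-- The properties of the map `u ↦ L g u (u + T)`, when it is finite. -/
structure IsSliding (T : ℝ) (r : ℝ → ℝ) : Prop where
  mono : Monotone r
  self_le : ∀ u, u ≤ r u
  le_add : ∀ u, r u ≤ u + T
  add_one : ∀ u, r (u + 1) = r u + 1
  coincide : ∀ u v, u < v → v ≤ r u → r v ≤ u + T → r u = r v

/-- The map `u ↦ L g u (u + T)`, with the value `∞` replaced by `u + e`. -/
noncomputable def filledLocation {H : PathClass} (L : H.carrier → ℝ → ℝ → WithTop ℝ)
    (g : H.carrier) (T e u : ℝ) : ℝ := (L g u (u + T)).untopD (u + e)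

namespace IsIntrinsicLocation

variable {H : PathClass} {L : H.carrier → ℝ → ℝ → WithTop ℝ} (hL : IsIntrinsicLocation H L)
  {T : ℝ} (hT : 0 < T) {g : H.carrier} {u v x y : ℝ}

include hL hT

theorem mem_Icc (h : L g u (u + T) = x) : x ∈ Icc u (u + T) := by
  rcases hL.mem_interval g u (u + T) (by linarith) with h' | ⟨z, hz, h'⟩
  · exact absurd (h.symm.trans h') WithTop.coe_ne_top
  · rwa [WithTop.coe_inj.1 (h.symm.trans h')]

/-- Both values are the location in the overlap `[v, u + T]`; when the overlap is a single point
they are that point. -/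
theorem eq_of_overlap (hu : L g u (u + T) = x) (hv : L g v (v + T) = y) (huv : u < v)
    (hx : v ≤ x) (hy : y ≤ u + T) : x = y := by
  have hx' := hL.mem_Icc hT hu
  have hy' := hL.mem_Icc hT hv
  rcases (hx.trans hx'.2).lt_or_eq with h | h
  · have h1 := hL.stable g u (u + T) v (u + T) h (Icc_subset_Icc huv.le le_rfl) ⟨x, ⟨hx, hx'.2⟩, hu⟩
    have h2 := hL.stable g v (v + T) v (u + T) h (Icc_subset_Icc le_rfl (by linarith))
      ⟨y, ⟨hy'.1, hy⟩, hv⟩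
    exact WithTop.coe_inj.1 (hu.symm.trans (h1.symm.trans (h2.trans hv)))
  · have := hx'.2
    have := hy'.1
    linarith

theorem location_mono (hu : L g u (u + T) = x) (hv : L g v (v + T) = y) (huv : u < v) :
    x ≤ y := by
  by_contra! h
  have hx' := hL.mem_Icc hT hu
  have hy' := hL.mem_Icc hT hv
  exact h.ne' (hL.eq_of_overlap hT hu hv huv (hy'.1.trans h.le) (h.le.trans hx'.2))

theorem ne_top_of_right (hu : L g u (u + T) = x) (huv : u < v) (hv : v < x) :
    L g v (v + T) ≠ ⊤ := by
  have hx' := hL.mem_Icc hT hu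
  have h : v < u + T := hv.trans_le hx'.2
  have h1 := hL.stable g u (u + T) v (u + T) h (Icc_subset_Icc huv.le le_rfl)
    ⟨x, ⟨hv.le, hx'.2⟩, hu⟩
  refine hL.consistent g v (v + T) v (u + T) h (Icc_subset_Icc le_rfl (by linarith)) ?_
  rw [h1, hu]
  exact WithTop.coe_ne_top

theorem ne_top_of_left (hv : L g v (v + T) = x) (huv : u < v) (hu : x < u + T) :
    L g u (u + T) ≠ ⊤ := by
  have hx' := hL.mem_Icc hT hv
  have h : v < u + T := hx'.1.trans_lt hu
  have h1 := hL.stable g v (v + T) v (u + T) h (Icc_subset_Icc le_rfl (by linarith))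
    ⟨x, ⟨hx'.1, hu.le⟩, hv⟩
  refine hL.consistent g u (u + T) v (u + T) h (Icc_subset_Icc huv.le le_rfl) ?_
  rw [h1, hv]
  exact WithTop.coe_ne_top

theorem location_add_one (g : H.carrier) (u : ℝ) :
    L g (u + 1) (u + 1 + T) = L g u (u + T) + ((1 : ℝ) : WithTop ℝ) := by
  rw [hL.shift_compatible g (u + 1) (u + 1 + T) 1 (by linarith)]
  have : H.shift 1 g = g := Subtype.ext (funext (H.periodic g g.2))
  rw [this]
  congr 2 <;> ring

theorem isSliding_filledLocation_of {e : ℝ} (he : 0 ≤ e) (he' : e ≤ T)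
    (hmono : ∀ u v, u < v → filledLocation L g T e u ≤ filledLocation L g T e v)
    (hco : ∀ u v, u < v → v ≤ filledLocation L g T e u → filledLocation L g T e v ≤ u + T →
      filledLocation L g T e u = filledLocation L g T e v) :
    IsSliding T (filledLocation L g T e) where
  mono := monotone_iff_forall_lt.2 fun u v => hmono u v
  self_le u := by
    cases h : L g u (u + T) with
    | top => simpa [filledLocation, h]
    | coe x => simpa [filledLocation, h] using (hL.mem_Icc hT h).1
  le_add u := by
    cases h : L g u (u + T) with
    | top => simpa [filledLocation, h]
    | coe x => simpa [filledLocation, h] using (hL.mem_Icc hT h).2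
  add_one u := by
    have h1 := hL.location_add_one hT g u
    cases h : L g u (u + T) with
    | top =>
      rw [h, WithTop.top_add] at h1
      simp only [filledLocation, h, h1, WithTop.untopD_top]
      ring
    | coe x =>
      rw [h, ← WithTop.coe_add] at h1
      simp only [filledLocation, h, h1, WithTop.untopD_coe]
  coincide := hco

/-- Monotonicity survives the filling: a finite `x > v` found from `u` lies in the overlap, which
forces a finite value at `v`. Thus before an `∞` at `v` the location is at most `v`. -/
theorem isSliding_filledLocation_zero (g : H.carrier) : IsSliding T (filledLocation L g T 0) := by
  have hmono (u v : ℝ) (huv : u < v) : filledLocation L g T 0 u ≤ filledLocation L g T 0 v := by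
    cases hu : L g u (u + T) with
    | top =>
      cases hv : L g v (v + T) with
      | top => simpa [filledLocation, hu, hv] using huv.le
      | coe y => simpa [filledLocation, hu, hv] using huv.le.trans (hL.mem_Icc hT hv).1
    | coe x =>
      cases hv : L g v (v + T) with
      | top =>
        simp only [filledLocation, hu, hv, WithTop.untopD_top, WithTop.untopD_coe, add_zero]
        by_contra! h
        exact hL.ne_top_of_right hT hu huv h hv
      | coe y => simpa [filledLocation, hu, hv] using hL.location_mono hT hu hv huv
  refine hL.isSliding_filledLocation_of hT le_rfl hT.le hmono fun u v huv h1 h2 => ?_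
  have h3 := hmono u v huv
  cases hu : L g u (u + T) with
  | top =>
    simp only [filledLocation, hu, WithTop.untopD_top] at h1
    linarith
  | coe x =>
    cases hv : L g v (v + T) with
    | top =>
      simp only [filledLocation, hu, hv, WithTop.untopD_top, WithTop.untopD_coe] at *
      linarith
    | coe y =>
      simp only [filledLocation, hu, hv, WithTop.untopD_coe] at h1 h2 ⊢
      exact hL.eq_of_overlap hT hu hv huv h1 h2

/-- The mirror image: after an `∞` at `u` the location is at least `u + T`. -/
theorem isSliding_filledLocation_right (g : H.carrier) :
    IsSliding T (filledLocation L g T T) := by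
  have hmono (u v : ℝ) (huv : u < v) : filledLocation L g T T u ≤ filledLocation L g T T v := by
    cases hv : L g v (v + T) with
    | top =>
      cases hu : L g u (u + T) with
      | top => simpa [filledLocation, hu, hv] using huv.le
      | coe x =>
        have := (hL.mem_Icc hT hu).2
        simp only [filledLocation, hu, hv, WithTop.untopD_top, WithTop.untopD_coe]
        linarith
    | coe y =>
      cases hu : L g u (u + T) with
      | top =>
        simp only [filledLocation, hu, hv, WithTop.untopD_top, WithTop.untopD_coe]
        by_contra! h
        exact hL.ne_top_of_left hT hv huv h hu
      | coe x => simpa [filledLocation, hu, hv] using hL.location_mono hT hu hv huv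
  refine hL.isSliding_filledLocation_of hT hT.le le_rfl hmono fun u v huv h1 h2 => ?_
  have h3 := hmono u v huv
  cases hv : L g v (v + T) with
  | top =>
    simp only [filledLocation, hv, WithTop.untopD_top] at h2
    linarith
  | coe y =>
    cases hu : L g u (u + T) with
    | top =>
      simp only [filledLocation, hu, hv, WithTop.untopD_top, WithTop.untopD_coe] at *
      linarith
    | coe x =>
      simp only [filledLocation, hu, hv, WithTop.untopD_coe] at h1 h2 ⊢
      exact hL.eq_of_overlap hT hu hv huv h1 h2

end IsIntrinsicLocation

/-! ### Positions of a point and crossings of a level -/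

/-- The positions inside `(0, T)` that the point `x` takes relative to the sliding window. -/
def positions (T : ℝ) (r : ℝ → ℝ) (x : ℝ) : Set ℝ := {t | t ∈ Ioo 0 T ∧ r (x - t) = x}

/-- The left end of the interval of positions of `x`. -/
noncomputable def lowPos (T : ℝ) (r : ℝ → ℝ) (x : ℝ) : ℝ := sInf (positions T r x)

/-- The right end of the interval of positions of `x`. -/
noncomputable def highPos (T : ℝ) (r : ℝ → ℝ) (x : ℝ) : ℝ := sSup (positions T r x)

/-- A filled value has relative position `e`, outside `(0, T)`, so it is never counted. Hence the
fillings `e = 0` and `e = T` have the same positions. -/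
theorem positions_filledLocation {H : PathClass} (L : H.carrier → ℝ → ℝ → WithTop ℝ)
    (g : H.carrier) {T e : ℝ} (he : e ∉ Ioo 0 T) (x : ℝ) :
    positions T (filledLocation L g T e) x =
      {t | t ∈ Ioo 0 T ∧ L g (x - t) (x - t + T) = x} := by
  ext t
  refine and_congr_right fun ht => ?_
  unfold filledLocation
  cases h : L g (x - t) (x - t + T) with
  | top =>
    refine iff_of_false (fun h' => he ?_) WithTop.top_ne_coe
    have : e = t := by
      simp only [WithTop.untopD_top] at h'
      linarith
    rwa [this]
  | coe y => simp [WithTop.coe_inj]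

namespace IsSliding

variable {T : ℝ} {r : ℝ → ℝ} (hr : IsSliding T r) {x t : ℝ}

theorem bddBelow_positions (T : ℝ) (r : ℝ → ℝ) (x : ℝ) : BddBelow (positions T r x) :=
  ⟨0, fun _ h => h.1.1.le⟩

theorem bddAbove_positions (T : ℝ) (r : ℝ → ℝ) (x : ℝ) : BddAbove (positions T r x) :=
  ⟨T, fun _ h => h.1.2.le⟩

theorem lowPos_le (h : t ∈ positions T r x) : lowPos T r x ≤ t :=
  csInf_le (bddBelow_positions T r x) h

theorem le_highPos (h : t ∈ positions T r x) : t ≤ highPos T r x :=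
  le_csSup (bddAbove_positions T r x) h

theorem highPos_le (hT : 0 < T) (x : ℝ) : highPos T r x ≤ T :=
  Real.sSup_le (fun _ h => h.1.2.le) hT.le

theorem lowPos_nonneg (x : ℝ) : 0 ≤ lowPos T r x := Real.sInf_nonneg fun _ h => h.1.1.le

include hr

theorem positions_add_one (x : ℝ) : positions T r (x + 1) = positions T r x := by
  ext t
  refine and_congr_right fun _ => ?_
  rw [show x + 1 - t = x - t + 1 by ring, hr.add_one]
  constructor <;> intro h <;> linarith

theorem lowPos_add_one (x : ℝ) : lowPos T r (x + 1) = lowPos T r x := by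
  rw [lowPos, hr.positions_add_one, lowPos]

theorem highPos_add_one (x : ℝ) : highPos T r (x + 1) = highPos T r x := by
  rw [highPos, hr.positions_add_one, highPos]

theorem mem_positions (h1 : lowPos T r x < t) (h2 : t < highPos T r x) :
    t ∈ positions T r x := by
  -- Without positions both ends take the default value `0`, which no `t` can separate.
  have hne : (positions T r x).Nonempty := by
    by_contra! h
    rw [lowPos, h, Real.sInf_empty] at h1
    rw [highPos, h, Real.sSup_empty] at h2
    linarith
  obtain ⟨a, ha, hat⟩ := exists_lt_of_csInf_lt hne h1
  obtain ⟨b, hb, htb⟩ := exists_lt_of_lt_csSup hne h2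
  refine ⟨⟨ha.1.1.trans hat, htb.trans hb.1.2⟩, le_antisymm ?_ ?_⟩
  · exact (hr.mono (by linarith : x - t ≤ x - a)).trans ha.2.le
  · exact hb.2.symm.le.trans (hr.mono (by linarith : x - b ≤ x - t))

theorem apply_sub_of_lt (h1 : lowPos T r x < t) (h2 : t < highPos T r x) : r (x - t) = x :=
  (hr.mem_positions h1 h2).2

/-- At the last moment `w` with `r - id` above `t`, monotonicity of `r` excludes a jump and gives `r
w = w + t`. Coincidence then makes `r` constant on both sides of `w`, so `t` is interior to the
positions of `w + t`. -/
theorem exists_crossing (ht : t ∈ Ioo 0 T) {u v : ℝ} (huv : u < v) (hu : u + t < r u)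
    (hv : r v < v + t) :
    ∃ y, lowPos T r y < t ∧ t < highPos T r y ∧ y - t ∈ Ioo u v := by
  set A : Set ℝ := {z | z ∈ Icc u v ∧ z + t < r z} with hA
  have huA : u ∈ A := ⟨⟨le_rfl, huv.le⟩, hu⟩
  have hAb : BddAbove A := ⟨v, fun z hz => hz.1.2⟩
  set w := sSup A with hw
  have huw : u ≤ w := le_csSup hAb huA
  have hwv : w ≤ v := csSup_le ⟨u, huA⟩ fun z hz => hz.1.2
  have hge : w + t ≤ r w := by
    rw [← le_sub_iff_add_le]
    refine csSup_le ⟨u, huA⟩ fun z hz => ?_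
    have := hr.mono (le_csSup hAb hz)
    linarith [hz.2]
  have hwv' : w < v := by
    rcases hwv.lt_or_eq with h | h
    · exact h
    · rw [h] at hge; linarith
  have hrw : r w = w + t := by
    refine le_antisymm ?_ hge
    by_contra! h
    obtain ⟨z, hz1, hz2⟩ := exists_between (lt_min hwv' (lt_sub_iff_add_lt.2 h))
    have : z ∈ A := ⟨⟨huw.trans hz1.le, (hz2.trans_le (min_le_left _ _)).le⟩, by
      have h1 := hr.mono hz1.le
      have h2 := hz2.trans_le (min_le_right _ _)
      linarith⟩
    exact hz1.not_ge (le_csSup hAb this)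
  have huw' : u < w := by
    rcases huw.lt_or_eq with h | h
    · exact h
    · rw [← h] at hrw; linarith
  -- The distance the window can slide either way while still containing `w + t`.
  have hm : 0 < min t (T - t) := lt_min ht.1 (sub_pos.2 ht.2)
  obtain ⟨a, ha, haw⟩ := exists_lt_of_lt_csSup ⟨u, huA⟩ (sub_lt_self w hm)
  have haw' : a < w := by
    refine lt_of_le_of_ne (le_csSup hAb ha) fun h => ?_
    have := ha.2
    rw [h] at this
    linarith
  have h1 : w - t < a := by linarith [min_le_left t (T - t)]
  have h2 : w - (T - t) < a := by linarith [min_le_right t (T - t)]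
  have hra : r a = r w := hr.coincide a w haw' (by linarith [ha.2]) (by linarith)
  obtain ⟨b, hwb, hb⟩ := exists_between (lt_min hwv' (lt_add_of_pos_right w hm))
  have hbv := hb.trans_le (min_le_left _ _)
  have hb' := hb.trans_le (min_le_right _ _)
  have h3 : b < w + t := by linarith [min_le_left t (T - t)]
  have h4 : b < w + (T - t) := by linarith [min_le_right t (T - t)]
  have hbA : r b ≤ b + t := by
    by_contra! h
    exact hwb.not_ge (le_csSup hAb ⟨⟨huw.trans hwb.le, hbv.le⟩, h⟩)
  have hrb : r w = r b := hr.coincide w b hwb (by linarith) (by linarith)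
  have hap : w + t - a ∈ positions T r (w + t) :=
    ⟨⟨by linarith [ht.1], by linarith⟩, by rw [sub_sub_cancel, hra, hrw]⟩
  have hbp : w + t - b ∈ positions T r (w + t) :=
    ⟨⟨by linarith [ht.1], by linarith [ht.2]⟩, by rw [sub_sub_cancel, ← hrb, hrw]⟩
  refine ⟨w + t, (lowPos_le hbp).trans_lt (by linarith),
    lt_of_lt_of_le (by linarith) (le_highPos hap), ?_⟩
  simpa using ⟨huw', hwv'⟩

/-- Just before a point appears at a position inside the window, the location is near the left end
of the window. -/
theorem exists_before_start (h1 : lowPos T r x < highPos T r x) (h2 : highPos T r x < T)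
    (ht : 0 < t) {v : ℝ} (hv : v < x - highPos T r x) :
    ∃ u ∈ Ioo v (x - highPos T r x), r u < u + t ∧ r u < x := by
  obtain ⟨u, hu, hux⟩ := exists_between (max_lt hv
    (max_lt (sub_lt_sub_left h2 x) (sub_lt_self (x - highPos T r x) ht)))
  have hu1 := (le_max_left _ _).trans_lt hu
  have hu2 := ((le_max_left _ _).trans (le_max_right _ _)).trans_lt hu
  have hu3 := ((le_max_right _ _).trans (le_max_right _ _)).trans_lt hu
  -- At `u'` the location is already `x`, and `u' < u + t`. If `r u ≥ u + t`, both locations would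
  -- lie in both windows and coincide, giving `x` a position above the highest one.
  obtain ⟨u', hu', hu''⟩ := exists_between (lt_min (sub_lt_sub_left h1 x)
    (by linarith : x - highPos T r x < u + t))
  have hu4 := hu''.trans_le (min_le_left _ _)
  have hu5 := hu''.trans_le (min_le_right _ _)
  have hru' : r u' = x := by
    have := hr.apply_sub_of_lt (x := x) (t := x - u') (by linarith) (by linarith)
    rwa [sub_sub_cancel] at this
  have hne : r u ≠ x := fun h => by
    have : x - u ∈ positions T r x :=
      ⟨⟨by linarith [lowPos_nonneg (T := T) (r := r) x], by linarith⟩, by rwa [sub_sub_cancel]⟩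
    have := le_highPos this
    linarith
  have hlt : r u < x := lt_of_le_of_ne (hru' ▸ hr.mono (hux.trans hu').le) hne
  refine ⟨u, ⟨hu1, hux⟩, ?_, hlt⟩
  by_contra! h
  have := hr.coincide u u' (hux.trans hu') (by linarith) (by linarith)
  exact hne (this.trans hru')

theorem exists_crossing_between {x' : ℝ} (hT : 0 < T) (ht : 0 < t) (hxx' : x < x')
    (h1 : lowPos T r x < highPos T r x) (h2 : t < highPos T r x)
    (h1' : lowPos T r x' < highPos T r x') (h2' : highPos T r x' < T) :
    ∃ y, lowPos T r y < t ∧ t < highPos T r y ∧ x ≤ y ∧ y < x' := by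
  obtain ⟨a, ha, hah⟩ := exists_between (max_lt h1 h2)
  obtain ⟨b, hab, hb⟩ := exists_between hah
  have ha1 := (le_max_left _ _).trans_lt ha
  have ha2 := (le_max_right _ _).trans_lt ha
  have hra := hr.apply_sub_of_lt ha1 hah
  have hrb := hr.apply_sub_of_lt (ha1.trans hab) hb
  have hle : x - a ≤ x' - highPos T r x' := by
    by_contra! h
    obtain ⟨v, hv, hv'⟩ := exists_between (lt_min h (sub_lt_sub_left h1' x'))
    have hv1 := hv'.trans_le (min_le_left _ _)
    have hv2 := hv'.trans_le (min_le_right _ _)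
    have := hr.apply_sub_of_lt (x := x') (t := x' - v) (by linarith) (by linarith)
    rw [sub_sub_cancel] at this
    have := hr.mono hv1.le
    linarith
  obtain ⟨u, hu, hru, hrux⟩ := hr.exists_before_start h1' h2' ht
    (by linarith : x - b < x' - highPos T r x')
  obtain ⟨y, hy1, hy2, hy3⟩ := hr.exists_crossing
    ⟨ht, h2.trans_le (highPos_le hT x)⟩ hu.1 (by linarith) hru
  have hry := hr.apply_sub_of_lt hy1 hy2
  refine ⟨y, hy1, hy2, ?_, ?_⟩
  · have := hr.mono hy3.1.le
    linarith
  · have := hr.mono hy3.2.le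
    linarith

end IsSliding

/-! ### Counting points in a period -/

/-- Sending each point of `Q` to the least element of `C` not below it is strictly increasing. -/
theorem Set.ncard_le_of_interleaved {Q C : Set ℝ} (hC : C.Finite) (h1 : ∀ x ∈ Q, ∃ y ∈ C, x ≤ y)
    (h2 : ∀ x ∈ Q, ∀ x' ∈ Q, x < x' → ∃ y ∈ C, x ≤ y ∧ y < x') : Q.ncard ≤ C.ncard := by
  have hex : ∀ x ∈ Q, ∃ y ∈ C, x ≤ y ∧ ∀ z ∈ C, x ≤ z → y ≤ z := by
    intro x hx
    obtain ⟨y₀, hy₀⟩ := h1 x hx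
    obtain ⟨y, hy, hmin⟩ := (C ∩ Ici x).exists_min_image id (hC.inter_of_left _) ⟨y₀, hy₀⟩
    exact ⟨y, hy.1, hy.2, fun z hz hxz => hmin z ⟨hz, hxz⟩⟩
  choose! n hnC hxn hmin using hex
  have key : ∀ x ∈ Q, ∀ x' ∈ Q, x < x' → n x < n x' := fun x hx x' hx' h => by
    obtain ⟨y, hy, hxy, hyx'⟩ := h2 x hx x' hx' h
    exact ((hmin x hx y hy hxy).trans_lt hyx').trans_le (hxn x' hx')
  exact ncard_le_ncard_of_injOn n hnC
    (StrictMonoOn.injOn fun x hx x' hx' h => key x hx x' hx' h) hC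

theorem Set.ncard_inter_Ico_le {A W : Set ℝ} (hA : ∀ x ∈ A, ∀ n : ℤ, x + n ∈ A)
    (hW : ∀ x : ℝ, ∃ n : ℤ, x + n ∈ W) (hfin : (A ∩ W).Finite) (a : ℝ) :
    (A ∩ Ico a (a + 1)).ncard ≤ (A ∩ W).ncard := by
  choose n hn using hW
  refine ncard_le_ncard_of_injOn (fun x => x + n x) (fun x hx => ⟨hA x hx.1 _, hn x⟩) ?_ hfin
  intro x hx y hy hxy
  have h1 := hx.2.1
  have h2 := hx.2.2
  have h3 := hy.2.1
  have h4 := hy.2.2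
  simp only at hxy
  have h5 : x - y = ((n y - n x : ℤ) : ℝ) := by push_cast; linarith
  have h6 : n y - n x < 1 := by exact_mod_cast (h5 ▸ (by linarith) : ((n y - n x : ℤ) : ℝ) < 1)
  have h7 : -1 < n y - n x := by
    exact_mod_cast (h5 ▸ (by linarith) : (-1 : ℝ) < ((n y - n x : ℤ) : ℝ))
  have h8 : n y - n x = 0 := by omega
  rw [h8] at h5
  push_cast at h5
  linarith

theorem exists_int_add_mem_Ico (a x : ℝ) : ∃ n : ℤ, x + n ∈ Ico a (a + 1) := by
  refine ⟨-⌊x - a⌋, ?_⟩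
  have h1 := Int.floor_le (x - a)
  have h2 := Int.lt_floor_add_one (x - a)
  push_cast
  constructor <;> linarith

theorem exists_int_add_mem_Ioc (a x : ℝ) : ∃ n : ℤ, x + n ∈ Ioc a (a + 1) := by
  obtain ⟨n, hn⟩ := exists_int_add_mem_Ico (-(a + 1)) (-x)
  refine ⟨-n, ?_⟩
  push_cast
  constructor <;> linarith [hn.1, hn.2]

/-- The points of which `t` is a position, with the intervals of positions closed on the left and
open on the right. -/
def activeAt (T : ℝ) (r : ℝ → ℝ) (t : ℝ) : Set ℝ := {x | lowPos T r x ≤ t ∧ t < highPos T r x}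

/-- The points with a highest position in `(s, t]`. -/
def startingIn (T : ℝ) (r : ℝ → ℝ) (s t : ℝ) : Set ℝ :=
  {x | lowPos T r x < highPos T r x ∧ s < highPos T r x ∧ highPos T r x ≤ t}

/-- The number of active points in a period: the density of the location. -/
noncomputable def activeCount (T : ℝ) (r : ℝ → ℝ) (t : ℝ) : ℝ :=
  ((activeAt T r t ∩ Ico 0 1).ncard : ℝ)

namespace IsSliding

variable {T : ℝ} {r : ℝ → ℝ} (hr : IsSliding T r) {x s t δ : ℝ}

include hr

theorem lowPos_add_int (x : ℝ) (n : ℤ) : lowPos T r (x + n) = lowPos T r x := by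
  have : Function.Periodic (lowPos T r) 1 := hr.lowPos_add_one
  simpa using this.int_mul n x

theorem highPos_add_int (x : ℝ) (n : ℤ) : highPos T r (x + n) = highPos T r x := by
  have : Function.Periodic (highPos T r) 1 := hr.highPos_add_one
  simpa using this.int_mul n x

theorem add_int_mem_activeAt (h : x ∈ activeAt T r t) (n : ℤ) : x + n ∈ activeAt T r t := by
  simpa only [activeAt, mem_ofPred_eq, hr.lowPos_add_int, hr.highPos_add_int] using h

theorem add_int_mem_startingIn (h : x ∈ startingIn T r s t) (n : ℤ) :
    x + n ∈ startingIn T r s t := by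
  simpa only [startingIn, mem_ofPred_eq, hr.lowPos_add_int, hr.highPos_add_int] using h

/-- Windows less than `δ` apart whose locations keep distance `δ` from their ends see the same
location. So distinct points use windows starting in distinct cells of length `δ`. -/
theorem finite_positions_meet (hδ : 0 < δ) (a b : ℝ) :
    {x | x ∈ Icc a b ∧ ∃ t ∈ positions T r x, δ ≤ t ∧ t ≤ T - δ}.Finite := by
  have hex : ∀ x ∈ {x | x ∈ Icc a b ∧ ∃ t ∈ positions T r x, δ ≤ t ∧ t ≤ T - δ},
      ∃ u, r u = x ∧ u ≤ x - δ ∧ x ≤ u + T - δ := by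
    rintro x ⟨_, t, ht, h1, h2⟩
    exact ⟨x - t, ht.2, by linarith, by linarith⟩
  choose! u hu1 hu2 hu3 using hex
  refine Finite.of_injOn (f := fun x => ⌊u x / δ⌋)
    (t := Icc ⌊(a - T) / δ⌋ ⌊b / δ⌋) ?_ ?_ (finite_Icc _ _)
  · intro x hx
    have h1 := hx.1.1
    have h2 := hx.1.2
    exact ⟨Int.floor_le_floor (div_le_div_of_nonneg_right (by linarith [hu3 x hx]) hδ.le),
      Int.floor_le_floor (div_le_div_of_nonneg_right (by linarith [hu2 x hx]) hδ.le)⟩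
  · have key : ∀ x ∈ {x | x ∈ Icc a b ∧ ∃ t ∈ positions T r x, δ ≤ t ∧ t ≤ T - δ},
        ∀ y ∈ {x | x ∈ Icc a b ∧ ∃ t ∈ positions T r x, δ ≤ t ∧ t ≤ T - δ},
        ⌊u x / δ⌋ = ⌊u y / δ⌋ → u x < u y → x = y := by
      intro x hx y hy hxy hlt
      have h1 := Int.abs_sub_lt_one_of_floor_eq_floor hxy
      rw [← sub_div, abs_div, abs_of_pos hδ, div_lt_one hδ] at h1
      have h2 := (abs_lt.1 h1).1
      rw [← hu1 x hx, ← hu1 y hy]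
      exact hr.coincide _ _ hlt (by linarith [hu2 x hx, hu1 x hx]) (by linarith [hu3 y hy, hu1 y hy])
    intro x hx y hy hxy
    rcases lt_trichotomy (u x) (u y) with h | h | h
    · exact key x hx y hy hxy h
    · rw [← hu1 x hx, ← hu1 y hy, h]
    · exact (key y hy x hx hxy.symm h).symm

theorem exists_position_of_mem_activeAt (hx : x ∈ activeAt T r t) (ht : t < s) :
    ∃ t' ∈ positions T r x, t < t' ∧ t' < s := by
  obtain ⟨t', h1, h2⟩ := exists_between (lt_min hx.2 ht)
  exact ⟨t', hr.mem_positions (hx.1.trans_lt h1) (h2.trans_le (min_le_left _ _)), h1,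
    h2.trans_le (min_le_right _ _)⟩

theorem finite_activeAt (ht : t ∈ Ioo 0 T) (a : ℝ) : (activeAt T r t ∩ Ico a (a + 1)).Finite := by
  have hδ : 0 < min t ((T - t) / 2) := lt_min ht.1 (by linarith [ht.2])
  refine (hr.finite_positions_meet hδ a (a + 1)).subset fun x hx => ⟨Ico_subset_Icc_self hx.2, ?_⟩
  obtain ⟨t', h1, h2, h3⟩ := hr.exists_position_of_mem_activeAt hx.1
    (by linarith [ht.2] : t < (t + T) / 2)
  exact ⟨t', h1, (min_le_left _ _).trans h2.le, by linarith [min_le_right t ((T - t) / 2)]⟩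

theorem finite_startingIn (hs : 0 < s) (ht : t < T) (a : ℝ) :
    (startingIn T r s t ∩ Icc a (a + 1)).Finite := by
  have hδ : 0 < min s (T - t) := lt_min hs (by linarith)
  refine (hr.finite_positions_meet hδ a (a + 1)).subset fun x hx => ⟨hx.2, ?_⟩
  obtain ⟨t', h1, h2⟩ := exists_between (max_lt hx.1.1 hx.1.2.1)
  refine ⟨t', hr.mem_positions ((le_max_left _ _).trans_lt h1) h2,
    (min_le_left _ _).trans ((le_max_right _ _).trans h1.le), ?_⟩
  linarith [min_le_right s (T - t), hx.1.2.2]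

theorem ncard_activeAt_window_le {a : ℝ} (ht : t ∈ Ioo 0 T) :
    ((activeAt T r t ∩ Ico a (a + 1)).ncard : ℝ) ≤ activeCount T r t := by
  have h := ncard_inter_Ico_le (W := Ico 0 1) (fun x hx n => hr.add_int_mem_activeAt hx n)
    (fun x => by simpa using exists_int_add_mem_Ico 0 x)
    (by simpa using hr.finite_activeAt ht 0) a
  exact Nat.cast_le.2 h

/-- Cyclic interleaving: each gap between consecutive starting points contains a point active at
`s`. -/
theorem ncard_startingIn_le (hs : 0 < s) (hst : s ≤ t) (ht : t < T) :
    ((startingIn T r s t ∩ Ico 0 1).ncard : ℝ) ≤ activeCount T r s := by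
  rcases (startingIn T r s t ∩ Ico 0 1).eq_empty_or_nonempty with h | h
  · rw [h, ncard_empty, Nat.cast_zero]
    exact Nat.cast_nonneg _
  have hfin : (startingIn T r s t ∩ Ico 0 1).Finite :=
    (hr.finite_startingIn hs ht 0).subset (inter_subset_inter_right _ (by
      rw [zero_add]; exact Ico_subset_Icc_self))
  obtain ⟨x₀, hx₀, hmin⟩ := exists_min_image _ id hfin h
  have hsT : s ∈ Ioo 0 T := ⟨hs, hst.trans_lt ht⟩
  have hT : 0 < T := hs.trans hsT.2
  refine le_trans ?_ (hr.ncard_activeAt_window_le (a := x₀) hsT)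
  rw [Nat.cast_le]
  have hcross : ∀ x ∈ startingIn T r s t ∩ Ico 0 1, ∀ x' ∈ startingIn T r s t, x < x' →
      x' ≤ x₀ + 1 → ∃ y ∈ activeAt T r s ∩ Ico x₀ (x₀ + 1), x ≤ y ∧ y < x' := by
    intro x hx x' hx' hlt hle
    obtain ⟨y, h1, h2, h3, h4⟩ := hr.exists_crossing_between hT hs hlt hx.1.1 hx.1.2.1 hx'.1
      (hx'.2.2.trans_lt ht)
    exact ⟨y, ⟨⟨h1.le, h2⟩, (hmin x hx).trans h3, h4.trans_le hle⟩, h3, h4⟩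
  -- The translate of the least point closes the cycle, so the gap after the last point counts too.
  have hx₀' : x₀ + 1 ∈ startingIn T r s t := by
    simpa using hr.add_int_mem_startingIn hx₀.1 1
  refine ncard_le_of_interleaved (hr.finite_activeAt hsT x₀) (fun x hx => ?_) fun x hx x' hx' h => ?_
  · obtain ⟨y, hy, hy', -⟩ := hcross x hx _ hx₀' (by linarith [hx.2.2, hx₀.2.1]) le_rfl
    exact ⟨y, hy, hy'⟩
  · exact hcross x hx x' hx'.1 h (by linarith [hx'.2.2, hx₀.2.1])

end IsSliding

/-! ### Total variation of the count -/

theorem eVariationOn_Ioo_le {f V : ℝ → ℝ} {a b : ℝ} (hab : a < b)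
    (h : ∀ s ∈ Icc a b, ∀ t ∈ Icc a b, s ≤ t → |f t - f s| ≤ V t - V s) :
    eVariationOn f (Ioo a b) ≤ ENNReal.ofReal (V b - V a) := by
  have hV : MonotoneOn V (Icc a b) := fun s hs t ht hst => by
    linarith [h s hs t ht hst, abs_nonneg (f t - f s)]
  refine le_trans ?_ ((eVariationOn.mono V Ioo_subset_Icc_self).trans ((by
    simpa using (hV.eVariationOn_eq (left_mem_Icc.2 hab.le) (right_mem_Icc.2 hab.le)).le)))
  refine iSup_le fun p => ?_
  refine le_trans ?_ (le_iSup _ p)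
  refine Finset.sum_le_sum fun i _ => ?_
  have hm := p.2.2.1 (Nat.le_succ i)
  have h1 := h _ (Ioo_subset_Icc_self (p.2.2.2 i)) _ (Ioo_subset_Icc_self (p.2.2.2 (i + 1))) hm
  rw [edist_dist, edist_dist, Real.dist_eq, Real.dist_eq]
  exact ENNReal.ofReal_le_ofReal (h1.trans (le_abs_self _))

namespace IsSliding

variable {T : ℝ} {r : ℝ → ℝ} (hr : IsSliding T r) {x s t δ : ℝ}

include hr

/-- The variation of the density is controlled by the number of points that start in the middle
of the window. -/
theorem eVariationOn_activeCount_le (hs : 0 < s) (hst : s < t) (ht : t < T) :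
    0 ≤ activeCount T r t - activeCount T r s +
        2 * ((startingIn T r s t ∩ Ico 0 1).ncard : ℝ) ∧
      eVariationOn (activeCount T r) (Ioo s t) ≤ ENNReal.ofReal (activeCount T r t -
        activeCount T r s + 2 * ((startingIn T r s t ∩ Ico 0 1).ncard : ℝ)) := by
  set G : ℝ → ℝ := fun t => ((startingIn T r s t ∩ Ico 0 1).ncard : ℝ) with hG
  have hGfin : ∀ v ≤ t, (startingIn T r s v ∩ Ico 0 1).Finite := fun v hv =>
    (hr.finite_startingIn hs (hv.trans_lt ht) 0).subset (inter_subset_inter_right _ (by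
      rw [zero_add]; exact Ico_subset_Icc_self))
  have hafin : ∀ v ∈ Icc s t, (activeAt T r v ∩ Ico 0 1).Finite := fun v hv => by
    simpa using hr.finite_activeAt ⟨hs.trans_le hv.1, hv.2.trans_lt ht⟩ 0
  -- `A v` is the disjoint union of the points active at `v` and those starting in `(s, v]`, and it
  -- grows with `v`. So the count is the difference of the nondecreasing functions `(A v).ncard` and
  -- `G`.
  set A : ℝ → Set ℝ := fun v => {x | lowPos T r x < highPos T r x ∧ lowPos T r x ≤ v ∧
    s < highPos T r x} ∩ Ico 0 1 with hA
  have hAu : ∀ v ∈ Icc s t, A v = (activeAt T r v ∩ Ico 0 1) ∪ (startingIn T r s v ∩ Ico 0 1) := by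
    intro v hv
    ext x
    simp only [hA, activeAt, startingIn, mem_inter_iff, mem_ofPred_eq, mem_union]
    constructor
    · rintro ⟨⟨h1, h2, h3⟩, h4⟩
      rcases lt_or_ge v (highPos T r x) with h | h
      · exact Or.inl ⟨⟨h2, h⟩, h4⟩
      · exact Or.inr ⟨⟨h1, h3, h⟩, h4⟩
    · rintro (⟨⟨h1, h2⟩, h3⟩ | ⟨⟨h1, h2, h3⟩, h4⟩)
      · exact ⟨⟨h1.trans_lt h2, h1, hv.1.trans_lt h2⟩, h3⟩
      · exact ⟨⟨h1, h1.le.trans h3, h2⟩, h4⟩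
  have hcard : ∀ v ∈ Icc s t, ((A v).ncard : ℝ) = activeCount T r v + G v := by
    intro v hv
    rw [hAu v hv, ncard_union_eq _ (hafin v hv) (hGfin v hv.2)]
    · push_cast; rfl
    · rw [disjoint_left]
      exact fun x h1 h2 => h1.1.2.not_ge h2.1.2.2
  have hAmono : ∀ v ∈ Icc s t, ∀ w ∈ Icc s t, v ≤ w → ((A v).ncard : ℝ) ≤ (A w).ncard := by
    intro v hv w hw hvw
    rw [Nat.cast_le]
    refine ncard_le_ncard (fun x hx => ⟨⟨hx.1.1, hx.1.2.1.trans hvw, hx.1.2.2⟩, hx.2⟩) ?_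
    rw [hAu w hw]
    exact (hafin w hw).union (hGfin w hw.2)
  have hGmono : ∀ v, ∀ w ∈ Icc s t, v ≤ w → G v ≤ G w := by
    intro v w hw hvw
    simp only [hG, Nat.cast_le]
    exact ncard_le_ncard (fun x hx => ⟨⟨hx.1.1, hx.1.2.1, hx.1.2.2.trans hvw⟩, hx.2⟩) (hGfin w hw.2)
  have hGs : G s = 0 := by
    have : startingIn T r s s = ∅ := by
      ext x
      simp only [startingIn, mem_ofPred_eq, mem_empty_iff_false, iff_false]
      exact fun h => h.2.1.not_ge h.2.2
    simp [hG, this]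
  have hV : ∀ v ∈ Icc s t, ∀ w ∈ Icc s t, v ≤ w → |activeCount T r w - activeCount T r v| ≤
      activeCount T r w + 2 * G w - (activeCount T r v + 2 * G v) := fun v hv w hw hvw => by
    have h1 := hAmono v hv w hw hvw
    have h2 := hGmono v w hw hvw
    rw [hcard v hv, hcard w hw] at h1
    rw [abs_le]
    constructor <;> linarith
  have heq : activeCount T r t + 2 * G t - (activeCount T r s + 2 * G s) =
      activeCount T r t - activeCount T r s + 2 * G t := by
    rw [hGs]
    ring
  constructor
  · rw [← heq]
    exact (abs_nonneg _).trans (hV s (left_mem_Icc.2 hst.le) t (right_mem_Icc.2 hst.le) hst.le)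
  · have := eVariationOn_Ioo_le hst hV
    rwa [heq] at this

/-- A constant does not affect the variation, and `f t - f s + 2 * G ≤ (f t - k) + (f s - k)` is
equivalent to `G ≤ f s - k`. -/
theorem variationConstraint_activeCount_sub {k : ℝ}
    (h : ∀ s t, 0 < s → s < t → t < T →
      ((startingIn T r s t ∩ Ico 0 1).ncard : ℝ) ≤ activeCount T r s - k) :
    VariationConstraint T fun t => activeCount T r t - k := by
  intro s t hs hst ht
  have hv : eVariationOn (fun t => activeCount T r t - k) (Ioo s t) =
      eVariationOn (activeCount T r) (Ioo s t) := by
    simp [eVariationOn, edist_dist, Real.dist_eq]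
  obtain ⟨hc, h1⟩ := hr.eVariationOn_activeCount_le hs hst ht
  rw [← hv] at h1
  refine ⟨(h1.trans_lt ENNReal.ofReal_lt_top).ne, ?_⟩
  have h2 := h s t hs hst ht
  have h3 := ENNReal.toReal_mono ENNReal.ofReal_ne_top h1
  rw [ENNReal.toReal_ofReal hc] at h3
  linarith

end IsSliding

/-! ### The count is a càdlàg density -/

theorem continuousWithinAt_indicator_Ico (a b t : ℝ) :
    ContinuousWithinAt ((Ico a b).indicator (1 : ℝ → ℝ)) (Ici t) t := by
  have key : ∀ c : ℝ, (∀ᶠ s in 𝓝[≥] t, (Ico a b).indicator (1 : ℝ → ℝ) s = c) →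
      ContinuousWithinAt ((Ico a b).indicator (1 : ℝ → ℝ)) (Ici t) t := fun c hc => by
    rw [ContinuousWithinAt, hc.self_of_nhdsWithin self_mem_Ici]
    exact tendsto_const_nhds.congr' (hc.mono fun _ h => h.symm)
  rcases lt_or_ge t a with h | h
  · refine key 0 ?_
    filter_upwards [mem_nhdsWithin_of_mem_nhds (Iio_mem_nhds h)] with s hs
    exact indicator_of_notMem (fun h' => h'.1.not_gt hs) _
  rcases lt_or_ge t b with h' | h'
  · refine key 1 ?_
    filter_upwards [Ico_mem_nhdsGE h'] with s hs
    exact indicator_of_mem (Ico_subset_Ico_left h hs) _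
  · refine key 0 ?_
    filter_upwards [self_mem_nhdsWithin] with s hs
    exact indicator_of_notMem (fun h'' => (h'.trans hs).not_gt h''.2) _

theorem exists_tendsto_indicator_Ico (a b t : ℝ) :
    ∃ l, Tendsto ((Ico a b).indicator (1 : ℝ → ℝ)) (𝓝[<] t) (𝓝 l) := by
  have key : ∀ c : ℝ, (∀ᶠ s in 𝓝[<] t, (Ico a b).indicator (1 : ℝ → ℝ) s = c) →
      ∃ l, Tendsto ((Ico a b).indicator (1 : ℝ → ℝ)) (𝓝[<] t) (𝓝 l) := fun c hc =>
    ⟨c, tendsto_const_nhds.congr' (hc.mono fun _ h => h.symm)⟩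
  rcases le_or_gt t a with h | h
  · refine key 0 ?_
    filter_upwards [self_mem_nhdsWithin] with s hs
    exact indicator_of_notMem (fun h' => (h'.1.trans_lt hs).not_ge h) _
  rcases le_or_gt t b with h' | h'
  · refine key 1 ?_
    filter_upwards [Ico_mem_nhdsLT h] with s hs
    exact indicator_of_mem (Ico_subset_Ico_right h' hs) _
  · refine key 0 ?_
    filter_upwards [mem_nhdsWithin_of_mem_nhds (Ioi_mem_nhds h')] with s hs
    exact indicator_of_notMem (fun h'' => lt_asymm h''.2 hs) _

namespace IsSliding

variable {T : ℝ} {r : ℝ → ℝ} (hr : IsSliding T r) {x s t δ : ℝ}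

include hr

/-- Near `t` only points with a position in `[δ, T - δ]` can be active, and there are finitely many
per period. -/
theorem exists_eventually_activeCount_eq (ht : t ∈ Ioo 0 T) :
    ∃ S : Finset ℝ, ∀ᶠ s in 𝓝 t, activeCount T r s =
      ∑ x ∈ S, (Ico (lowPos T r x) (highPos T r x)).indicator (1 : ℝ → ℝ) s := by
  obtain ⟨δ, hδ, hδ'⟩ := exists_between (lt_min ht.1 (sub_pos.2 ht.2))
  have h1 := hδ'.trans_le (min_le_left _ _)
  have h2 := hδ'.trans_le (min_le_right _ _)
  have hfin : {x | x ∈ Ico (0 : ℝ) 1 ∧ ∃ t ∈ positions T r x, δ ≤ t ∧ t ≤ T - δ}.Finite :=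
    (hr.finite_positions_meet hδ 0 1).subset fun x hx => ⟨Ico_subset_Icc_self hx.1, hx.2⟩
  refine ⟨hfin.toFinset, ?_⟩
  classical
  filter_upwards [Ioo_mem_nhds h1 (by linarith : t < T - δ)] with s hs
  have heq : activeAt T r s ∩ Ico 0 1 = ↑(hfin.toFinset.filter fun x => x ∈ activeAt T r s) := by
    ext x
    simp only [Finset.coe_filter, Finite.mem_toFinset, mem_ofPred_eq, mem_inter_iff]
    constructor
    · rintro ⟨h3, h4⟩
      obtain ⟨t', h5, h6, h7⟩ := hr.exists_position_of_mem_activeAt h3 hs.2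
      exact ⟨⟨h4, t', h5, hs.1.le.trans h6.le, h7.le⟩, h3⟩
    · rintro ⟨⟨h3, -⟩, h4⟩
      exact ⟨h4, h3⟩
  rw [activeCount, heq, ncard_coe_finset, Finset.card_filter]
  push_cast
  refine Finset.sum_congr rfl fun x _ => ?_
  rw [indicator_apply]
  exact if_congr Iff.rfl rfl rfl

theorem continuousWithinAt_activeCount (ht : t ∈ Ioo 0 T) :
    ContinuousWithinAt (activeCount T r) (Ici t) t := by
  obtain ⟨S, hS⟩ := hr.exists_eventually_activeCount_eq ht
  refine ContinuousWithinAt.congr_of_eventuallyEq ?_ (hS.filter_mono nhdsWithin_le_nhds)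
    hS.self_of_nhds
  exact tendsto_finsetSum _ fun x _ => continuousWithinAt_indicator_Ico _ _ t

theorem exists_tendsto_activeCount (ht : t ∈ Ioo 0 T) :
    ∃ l, Tendsto (activeCount T r) (𝓝[<] t) (𝓝 l) := by
  obtain ⟨S, hS⟩ := hr.exists_eventually_activeCount_eq ht
  choose l hl using fun x => exists_tendsto_indicator_Ico (lowPos T r x) (highPos T r x) t
  refine ⟨∑ x ∈ S, l x, (tendsto_finsetSum S fun x _ => hl x).congr' ?_⟩
  filter_upwards [hS.filter_mono nhdsWithin_le_nhds] with s hs using hs.symm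

theorem apply_add_int (u : ℝ) (n : ℤ) : r (u + n) = r u + n := by
  have h : Function.Periodic (fun u => r u - u) 1 := fun u => by
    simp only [hr.add_one]
    ring
  have := h.int_mul n u
  simp only [mul_one] at this
  linarith

/-- Both windows are fundamental domains because `r` commutes with integer translations. This trades
moments in a period for locations in a period. -/
theorem volume_inter_preimage_Ico {E : Set ℝ} (hE : MeasurableSet E)
    (hE' : ∀ (n : ℤ) (u : ℝ), u + n ∈ E ↔ u ∈ E) :
    volume (E ∩ Ico 0 1) = volume (E ∩ r ⁻¹' Ico 0 1) := by
  have hdom {q : ℝ → ℝ} (hq : Measurable q) (hq' : ∀ u (n : ℤ), q (u + n) = q u + n) :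
      IsAddFundamentalDomain (AddSubgroup.zmultiples (1 : ℝ)) (q ⁻¹' Ico 0 1) volume := by
    refine IsAddFundamentalDomain.mk' (hq measurableSet_Ico).nullMeasurableSet fun u => ?_
    have h (g : AddSubgroup.zmultiples (1 : ℝ)) : q (g +ᵥ u) = q u + g := by
      obtain ⟨_, k, rfl⟩ := g
      simpa [AddSubgroup.vadd_def, add_comm] using hq' u k
    have := existsUnique_add_zsmul_mem_Ico (zero_lt_one (α := ℝ)) (q u) 0
    obtain ⟨k, hk, hk'⟩ := this
    refine ⟨⟨k • 1, k, rfl⟩, ?_, ?_⟩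
    · simpa only [mem_preimage, h, zero_add] using hk
    · rintro ⟨_, m, rfl⟩ hm
      have := hk' m (by simpa only [mem_preimage, h, zero_add] using hm)
      simp [this]
  have h1 := (hdom hr.mono.measurable hr.apply_add_int).measure_set_eq
    (hdom measurable_id fun _ _ => rfl) hE (by
      rintro ⟨_, k, rfl⟩
      ext u
      simpa [AddSubgroup.vadd_def, add_comm] using hE' k u)
  rw [h1, preimage_id]

theorem countable_positions_nonempty :
    {x | x ∈ Ico (0 : ℝ) 1 ∧ (positions T r x).Nonempty}.Countable := by
  refine (countable_iUnion fun n : ℕ => (hr.finite_positions_meet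
    (Nat.one_div_pos_of_nat (α := ℝ) (n := n)) 0 1).countable).mono ?_
  rintro x ⟨hx, t, ht⟩
  obtain ⟨n, hn⟩ := exists_nat_one_div_lt (lt_min ht.1.1 (sub_pos.2 ht.1.2))
  refine mem_iUnion.2 ⟨n, Ico_subset_Icc_self hx, t, ht, (hn.trans_le (min_le_left _ _)).le, ?_⟩
  linarith [min_le_right t (T - t)]

theorem positions_ae_eq (x : ℝ) :
    positions T r x =ᵐ[volume] Ico (lowPos T r x) (highPos T r x) := by
  have h1 : Ioo (lowPos T r x) (highPos T r x) ⊆ positions T r x :=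
    fun t ht => hr.mem_positions ht.1 ht.2
  have h2 : positions T r x ⊆ Icc (lowPos T r x) (highPos T r x) :=
    fun t ht => ⟨lowPos_le ht, le_highPos ht⟩
  refine (LE.le.eventuallyLE h2 |>.trans Ico_ae_eq_Icc.symm.le).antisymm
    (Ioo_ae_eq_Ico.symm.le.trans (LE.le.eventuallyLE h1))

theorem tsum_indicator_positions (ht : t ∈ Ioo 0 T) :
    ∑' x : {x | x ∈ Ico (0 : ℝ) 1 ∧ (positions T r x).Nonempty},
      (Ico (lowPos T r x) (highPos T r x)).indicator (1 : ℝ → ENNReal) t =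
        ENNReal.ofReal (activeCount T r t) := by
  have hfin : (activeAt T r t ∩ Ico 0 1).Finite := by simpa using hr.finite_activeAt ht 0
  rw [tsum_subtype {x | x ∈ Ico (0 : ℝ) 1 ∧ (positions T r x).Nonempty}
    (fun x => (Ico (lowPos T r x) (highPos T r x)).indicator (1 : ℝ → ENNReal) t)]
  have h (x : ℝ) : {x | x ∈ Ico (0 : ℝ) 1 ∧ (positions T r x).Nonempty}.indicator
      (fun x => (Ico (lowPos T r x) (highPos T r x)).indicator (1 : ℝ → ENNReal) t) x =
      (↑hfin.toFinset : Set ℝ).indicator 1 x := by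
    by_cases hx : x ∈ activeAt T r t ∩ Ico 0 1
    · obtain ⟨t', ht', -⟩ := hr.exists_position_of_mem_activeAt hx.1 ht.2
      have hx' : x ∈ {x | x ∈ Ico (0 : ℝ) 1 ∧ (positions T r x).Nonempty} := ⟨hx.2, t', ht'⟩
      have hx'' : t ∈ Ico (lowPos T r x) (highPos T r x) := hx.1
      rw [hfin.coe_toFinset, indicator_of_mem hx, indicator_of_mem hx', indicator_of_mem hx'']
      rfl
    · rw [hfin.coe_toFinset, indicator_of_notMem hx]
      by_cases hx' : x ∈ Ico (0 : ℝ) 1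
      · have hx'' : t ∉ Ico (lowPos T r x) (highPos T r x) := fun h => hx ⟨h, hx'⟩
        exact indicator_apply_eq_zero.2 fun _ => indicator_of_notMem hx'' _
      · exact indicator_of_notMem (fun h => hx' h.1) _
  rw [tsum_congr h, ← sum_eq_tsum_indicator, activeCount, ncard_eq_toFinset_card _ hfin]
  simp

theorem aemeasurable_activeCount :
    AEMeasurable (activeCount T r) (volume.restrict (Ioo 0 T)) := by
  have : Countable {x | x ∈ Ico (0 : ℝ) 1 ∧ (positions T r x).Nonempty} :=
    hr.countable_positions_nonempty
  have hm : Measurable fun t => ∑' x : {x | x ∈ Ico (0 : ℝ) 1 ∧ (positions T r x).Nonempty},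
      (Ico (lowPos T r x) (highPos T r x)).indicator (1 : ℝ → ENNReal) t :=
    Measurable.tsum fun x => measurable_one.indicator measurableSet_Ico
  refine ⟨_, hm.ennreal_toReal, ?_⟩
  filter_upwards [ae_restrict_mem measurableSet_Ioo] with t ht
  rw [hr.tsum_indicator_positions ht]
  exact (ENNReal.toReal_ofReal (Nat.cast_nonneg _)).symm

/-- `activeCount` is the density of the relative position `r u - u` for a uniform `u`. -/
theorem volume_relative_position {B : Set ℝ} (hB : MeasurableSet B) (hBT : B ⊆ Ioo 0 T) :
    volume ({u | r u - u ∈ B} ∩ Ico 0 1) = ∫⁻ t in B, ENNReal.ofReal (activeCount T r t) := by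
  have hrm : Measurable r := hr.mono.measurable
  have hE : MeasurableSet {u | r u - u ∈ B} := (hrm.sub measurable_id) hB
  have hM (x : ℝ) : MeasurableSet {u | r u = x ∧ x - u ∈ B} :=
    (hrm (measurableSet_singleton x)).inter ((measurable_const.sub measurable_id) hB)
  rw [hr.volume_inter_preimage_Ico hE fun n u => by simp [hr.apply_add_int]]
  have hU : {u | r u - u ∈ B} ∩ r ⁻¹' Ico 0 1 =
      ⋃ x ∈ {x | x ∈ Ico (0 : ℝ) 1 ∧ (positions T r x).Nonempty}, {u | r u = x ∧ x - u ∈ B} := by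
    ext u
    simp only [mem_inter_iff, mem_ofPred_eq, mem_preimage, mem_iUnion, exists_prop]
    constructor
    · rintro ⟨h1, h2⟩
      exact ⟨r u, ⟨h2, r u - u, hBT h1, by rw [sub_sub_cancel]⟩, rfl, h1⟩
    · rintro ⟨x, ⟨h1, -⟩, rfl, h2⟩
      exact ⟨h2, h1⟩
  have hcount := hr.countable_positions_nonempty
  rw [hU, measure_biUnion hcount (fun x _ y _ hxy => disjoint_left.2 fun u h1 h2 =>
    hxy (h1.1.symm.trans h2.1)) fun x _ => hM x]
  -- The reflection `u ↦ x - u` turns the moments when `x` is the location into its positions.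
  have hvol (x : ℝ) : volume {u | r u = x ∧ x - u ∈ B} =
      ∫⁻ t in B, (Ico (lowPos T r x) (highPos T r x)).indicator (1 : ℝ → ENNReal) t := by
    have h1 := (Measure.measurePreserving_sub_left (volume : Measure ℝ) x).measure_preimage
      (hM x).nullMeasurableSet
    have h2 : (fun u => x - u) ⁻¹' {u | r u = x ∧ x - u ∈ B} = positions T r x ∩ B := by
      ext t
      simp only [mem_preimage, mem_ofPred_eq, sub_sub_cancel, positions, mem_inter_iff]
      exact ⟨fun h => ⟨⟨hBT h.2, h.1⟩, h.2⟩, fun h => ⟨h.1.2, h.2⟩⟩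
    rw [← h1, h2, measure_congr ((hr.positions_ae_eq x).inter (ae_eq_refl B)),
      lintegral_indicator_one measurableSet_Ico, Measure.restrict_apply measurableSet_Ico]
  simp_rw [hvol]
  have : Countable {x | x ∈ Ico (0 : ℝ) 1 ∧ (positions T r x).Nonempty} := hcount
  rw [← lintegral_tsum fun x => (measurable_one.indicator measurableSet_Ico).aemeasurable]
  exact setLIntegral_congr_fun hB fun t ht => hr.tsum_indicator_positions (hBT ht)

end IsSliding

/-- Two càdlàg densities of the same measure agree on `(0, T)`. -/
theorem IsCadlagDensity.eqOn {F : Measure (WithTop ℝ)} {T : ℝ} {f g : ℝ → ℝ}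
    (hf : IsCadlagDensity F T f) (hg : IsCadlagDensity F T g) : EqOn f g (Ioo 0 T) := by
  have hae : f =ᵐ[volume.restrict (Ioo 0 T)] g := by
    refine Integrable.ae_eq_of_forall_setIntegral_eq _ _ hf.integrableOn hg.integrableOn
      fun s hs _ => ?_
    rw [Measure.restrict_restrict hs, ← hf.density _ (hs.inter measurableSet_Ioo)
      inter_subset_right, ← hg.density _ (hs.inter measurableSet_Ioo) inter_subset_right]
  intro t ht
  have hfreq : ∃ᶠ s in 𝓝[>] t, f s = g s := by
    intro hne
    obtain ⟨b, hb, hb'⟩ := (mem_nhdsGT_iff_exists_Ioo_subset' ht.2).1 hne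
    have h1 : volume (Ioo t (min b T)) = 0 := by
      refine measure_mono_null (fun s hs => ?_) ((ae_restrict_iff' measurableSet_Ioo).1 hae)
      intro h
      exact hb' ⟨hs.1, hs.2.trans_le (min_le_left _ _)⟩
        (h ⟨ht.1.trans hs.1, hs.2.trans_le (min_le_right _ _)⟩)
    rw [Real.volume_Ioo, ENNReal.ofReal_eq_zero] at h1
    linarith [lt_min hb ht.2]
  have hf' := (hf.right_continuous t ht).mono_left (nhdsWithin_mono t Ioi_subset_Ici_self)
  have hg' := (hg.right_continuous t ht).mono_left (nhdsWithin_mono t Ioi_subset_Ici_self)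
  exact tendsto_nhds_unique_of_frequently_eq hf' hg' hfreq

/-! ### Lower bound and the extra crossing -/

namespace IsSliding

variable {T : ℝ} {r q : ℝ → ℝ} (hr : IsSliding T r) {x s t u₀ : ℝ}

include hr

theorem one_le_activeCount (ht : t ∈ Ioo 0 T) (h : (activeAt T r t).Nonempty) :
    1 ≤ activeCount T r t := by
  obtain ⟨y, hy⟩ := h
  obtain ⟨n, hn⟩ := exists_int_add_mem_Ico 0 y
  have hfin := hr.finite_activeAt ht 0
  rw [zero_add] at hfin hn
  have : (activeAt T r t ∩ Ico 0 1).Nonempty := ⟨_, hr.add_int_mem_activeAt hy n, hn⟩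
  have := (ncard_pos hfin).2 this
  exact_mod_cast Nat.one_le_cast.2 this

/-- Right-continuity of the count covers a single exceptional position. -/
theorem one_le_activeCount_of_forall_ne (ht : t ∈ Ioo 0 T) {c : ℝ}
    (h : ∀ s ∈ Ioo 0 T, s ≠ c → 1 ≤ activeCount T r s) : 1 ≤ activeCount T r t := by
  by_cases htc : t = c
  · refine ge_of_tendsto
      ((hr.continuousWithinAt_activeCount ht).mono_left (nhdsWithin_mono t Ioi_subset_Ici_self)) ?_
    filter_upwards [Ioo_mem_nhdsGT ht.2] with s hs
    exact h s ⟨ht.1.trans hs.1, hs.2⟩ (htc ▸ hs.1.ne')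
  · exact h t ht htc

variable (hq : IsSliding T q) (hrq : ∀ x, positions T r x = positions T q x)
  (hr₀ : r u₀ = u₀) (hq₀ : q u₀ = u₀ + T)

include hq hrq hr₀ hq₀

/-- With `u` moved into the period after `u₀`: a relative position above `t` must descend through
`t` to `0` at `u₀ + 1` (filling `r`); one below `t` has descended from `T` at `u₀` (filling `q`). -/
theorem activeAt_nonempty_of_escape (ht : t ∈ Ioo 0 T) {u : ℝ} (hu : r u = q u)
    (hut : t ≠ r u - u) : (activeAt T r t).Nonempty := by
  obtain ⟨n, hn⟩ := exists_int_add_mem_Ioc u₀ u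
  have h1 := hr.apply_add_int u n
  have h2 := hq.apply_add_int u n
  rcases lt_or_gt_of_ne hut with h | h
  · have hlt : u + n < u₀ + 1 := by
      refine lt_of_le_of_ne hn.2 fun he => ?_
      rw [he, hr.add_one] at h1
      rw [he, hq.add_one] at h2
      linarith [ht.1.trans ht.2]
    obtain ⟨y, h3, h4, -⟩ := hr.exists_crossing ht hlt (by linarith)
      (by rw [hr.add_one]; linarith [ht.1])
    exact ⟨y, h3.le, h4⟩
  · obtain ⟨y, h3, h4, -⟩ := hq.exists_crossing ht hn.1 (by linarith [ht.2]) (by linarith)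
    refine ⟨y, ?_, ?_⟩
    · rw [lowPos, hrq]; exact h3.le
    · rw [highPos, hrq]; exact h4

/-- If the location is `∞` at some time, then some point is active beyond those required by the
points starting in the middle of the window. -/
theorem ncard_startingIn_add_one_le (hs : 0 < s) (hst : s ≤ t) (ht : t < T)
    (hone : 1 ≤ activeCount T r s) :
    ((startingIn T r s t ∩ Ico 0 1).ncard : ℝ) ≤ activeCount T r s - 1 := by
  have hsT : s ∈ Ioo 0 T := ⟨hs, hst.trans_lt ht⟩
  have hT : 0 < T := hs.trans hsT.2
  -- The period is cut at the infinite moment: as `r u₀ = u₀`, points of `Q` are locations only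
  -- after `u₀`.
  set Q : Set ℝ := startingIn T r s t ∩ Ioc u₀ (u₀ + 1) with hQ
  set C : Set ℝ := activeAt T r s ∩ {y | y - s ∈ Ioo u₀ (u₀ + 1)} with hC
  have hQfin : Q.Finite := (hr.finite_startingIn hs ht u₀).subset
    (inter_subset_inter_right _ Ioc_subset_Icc_self)
  have hCsub : C ⊆ activeAt T r s ∩ Ico (u₀ + s) (u₀ + s + 1) :=
    fun y hy => ⟨hy.1, by linarith [hy.2.1], by linarith [hy.2.2]⟩
  have hfin := hr.finite_activeAt hsT (u₀ + s)
  have hQle : (startingIn T r s t ∩ Ico 0 1).ncard ≤ Q.ncard := by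
    simpa using ncard_inter_Ico_le (fun x hx n => hr.add_int_mem_startingIn hx n)
      (exists_int_add_mem_Ioc u₀) hQfin 0
  rcases Q.eq_empty_or_nonempty with hQe | ⟨x₀, hx₀⟩
  · rw [hQe, ncard_empty, nonpos_iff_eq_zero] at hQle
    rw [hQle, Nat.cast_zero]
    linarith
  have hpos {x : ℝ} (hx : x ∈ Q) : ∃ a, s < a ∧ lowPos T r x < a ∧ a < highPos T r x ∧
      u₀ < x - a ∧ r (x - a) = x := by
    obtain ⟨a, ha, ha'⟩ := exists_between (max_lt hx.1.1 hx.1.2.1)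
    have ha1 := (le_max_left _ _).trans_lt ha
    have hra := hr.apply_sub_of_lt ha1 ha'
    refine ⟨a, (le_max_right _ _).trans_lt ha, ha1, ha', ?_, hra⟩
    by_contra! h
    have := hr.mono h
    linarith [hx.2.1]
  have hafter : ∀ x ∈ Q, ∃ y ∈ C, x ≤ y := by
    intro x hx
    obtain ⟨a, ha1, ha2, ha3, ha4, ha5⟩ := hpos hx
    obtain ⟨y, h1, h2, h3⟩ := hr.exists_crossing (u := x - a) (v := u₀ + 1) hsT
      (by linarith [hx.2.2]) (by linarith) (by rw [hr.add_one]; linarith)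
    refine ⟨y, ⟨⟨h1.le, h2⟩, ha4.trans h3.1, h3.2⟩, ?_⟩
    have := hr.mono h3.1.le
    rwa [ha5, hr.apply_sub_of_lt h1 h2] at this
  -- Under `q` the relative position is `T` at `u₀` and near `0` just before `x` appears, so level
  -- `s` is crossed in between.
  have hbefore : ∀ x ∈ Q, ∃ y ∈ C, u₀ ≤ y ∧ y < x := by
    intro x hx
    obtain ⟨a, ha1, ha2, ha3, ha4, ha5⟩ := hpos hx
    have hlow : lowPos T q x = lowPos T r x := by rw [lowPos, lowPos, hrq]
    have hhigh : highPos T q x = highPos T r x := by rw [highPos, highPos, hrq]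
    have hqa : q (x - a) = x := hq.apply_sub_of_lt (hlow ▸ ha2) (hhigh ▸ ha3)
    have h1 := hq.mono ha4.le
    rw [hqa, hq₀] at h1
    have h2 := hx.1.2.2
    obtain ⟨u, hu, hu1, hu2⟩ := hq.exists_before_start (x := x) (t := s) (v := u₀)
      (by rw [hlow, hhigh]; exact hx.1.1) (by rw [hhigh]; linarith) hs (by rw [hhigh]; linarith)
    obtain ⟨y, h3, h4, h5⟩ := hq.exists_crossing hsT hu.1 (by rw [hq₀]; linarith [hsT.2]) hu1
    have h6 := hq.mono h5.2.le
    rw [hq.apply_sub_of_lt h3 h4] at h6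
    have hu3 := hu.2
    rw [hhigh] at hu3
    refine ⟨y, ⟨⟨?_, ?_⟩, h5.1, by linarith [h5.2, hx.2.2]⟩, by linarith [h5.1], by linarith⟩
    · rw [lowPos, hrq]; exact h3.le
    · rw [highPos, hrq]; exact h4
  have hbetween : ∀ x ∈ Q, ∀ x' ∈ Q, x < x' → ∃ y ∈ C, x ≤ y ∧ y < x' := by
    intro x hx x' hx' hlt
    obtain ⟨y, h1, h2, h3, h4⟩ := hr.exists_crossing_between hT hs hlt hx.1.1 hx.1.2.1 hx'.1.1
      (hx'.1.2.2.trans_lt ht)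
    refine ⟨y, ⟨⟨h1.le, h2⟩, ?_, by linarith [hx'.2.2]⟩, h3, h4⟩
    by_contra! h
    have := hr.mono h
    rw [hr.apply_sub_of_lt h1 h2] at this
    linarith [hx.2.1]
  -- `u₀` acts as an additional point to the left of `Q`; the crossing before the first start
  -- separates it from `Q` and accounts for the `+ 1`.
  have hcard : (insert u₀ Q).ncard ≤ C.ncard := by
    refine ncard_le_of_interleaved (hfin.subset hCsub) ?_ ?_
    · rintro x (rfl | hx)
      · obtain ⟨y, hy, h1, -⟩ := hbefore x₀ hx₀
        exact ⟨y, hy, h1⟩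
      · exact hafter x hx
    · rintro x (rfl | hx) x' (rfl | hx') hlt
      · exact absurd hlt (lt_irrefl _)
      · exact hbefore x' hx'
      · exact absurd hlt hx.2.1.not_gt
      · exact hbetween x hx x' hx' hlt
  rw [ncard_insert_of_notMem (fun h => lt_irrefl _ h.2.1) hQfin] at hcard
  have h1 := ncard_le_ncard hCsub hfin
  have h2 := hr.ncard_activeAt_window_le (a := u₀ + s) hsT
  have h3 : (((startingIn T r s t ∩ Ico 0 1).ncard + 1 : ℕ) : ℝ) ≤
      ((activeAt T r s ∩ Ico (u₀ + s) (u₀ + s + 1)).ncard : ℝ) := Nat.cast_le.2 (by omega)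
  push_cast at h3
  linarith

end IsSliding

/-! ### Return to the law of the location -/

theorem VariationConstraint.congr {T : ℝ} {f g : ℝ → ℝ} (hfg : EqOn f g (Ioo 0 T))
    (hf : VariationConstraint T f) : VariationConstraint T g := by
  intro s t hs hst ht
  have hsub : Ioo s t ⊆ Ioo 0 T := Ioo_subset_Ioo hs.le ht.le
  rw [BoundedVariationOn, ← eVariationOn.congr (hfg.mono hsub), ← hfg ⟨hs, hst.trans ht⟩,
    ← hfg ⟨hs.trans hst, ht⟩]
  exact hf s t hs hst ht

namespace IsIntrinsicLocation

variable {H : PathClass} {L : H.carrier → ℝ → ℝ → WithTop ℝ} (hL : IsIntrinsicLocation H L)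
  {T : ℝ} (hT : 0 < T) {g : H.carrier}

include hL hT

theorem isCadlagDensity_activeCount {F : Measure (WithTop ℝ)} [IsFiniteMeasure F]
    (hF : ∀ B : Set ℝ, MeasurableSet B → F (finitePart B) =
      volume ({u | ∃ x ∈ B, L g u (u + T) = ((u + x : ℝ) : WithTop ℝ)} ∩ Ico 0 1)) :
    IsCadlagDensity F T (activeCount T (filledLocation L g T 0)) := by
  have hr := hL.isSliding_filledLocation_zero hT g
  have hnn (t : ℝ) : 0 ≤ activeCount T (filledLocation L g T 0) t := Nat.cast_nonneg _
  have key (B : Set ℝ) (hB : MeasurableSet B) (hBT : B ⊆ Ioo 0 T) : F (finitePart B) =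
      ∫⁻ t in B, ENNReal.ofReal (activeCount T (filledLocation L g T 0) t) := by
    rw [hF B hB, ← hr.volume_relative_position hB hBT]
    congr 2
    ext u
    cases h : L g u (u + T) with
    | top =>
      have : filledLocation L g T 0 u - u = 0 := by simp [filledLocation, h]
      simp only [mem_ofPred_eq, h, this]
      exact iff_of_false (fun ⟨x, _, hx⟩ => WithTop.top_ne_coe hx)
        fun h0 => lt_irrefl _ (hBT h0).1
    | coe y =>
      have : filledLocation L g T 0 u - u = y - u := by simp [filledLocation, h]
      simp only [mem_ofPred_eq, h, this, WithTop.coe_inj]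
      constructor
      · rintro ⟨x, hx, rfl⟩
        rwa [add_sub_cancel_left]
      · exact fun hy => ⟨_, hy, by ring⟩
  have hm := hr.aemeasurable_activeCount.aestronglyMeasurable
  refine ⟨⟨hm, ?_⟩, fun B hB hBT => ?_, fun t ht => hr.continuousWithinAt_activeCount ht,
    fun t ht => hr.exists_tendsto_activeCount ht⟩
  · rw [hasFiniteIntegral_iff_ofReal (ae_of_all _ hnn), ← key _ measurableSet_Ioo le_rfl]
    exact measure_lt_top _ _
  · rw [Measure.real, key B hB hBT, integral_eq_lintegral_of_nonneg_ae (ae_of_all _ hnn)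
      (hm.mono_measure (Measure.restrict_mono hBT le_rfl))]

/-- Mass outside `[0, t]` and outside `[t, T]` gives moments with relative position above and below
`t`; an integer translation puts the latter after the former, so `t` is crossed. -/
theorem activeAt_nonempty_of_forall_ne_top {F : Measure (WithTop ℝ)}
    (hF : ∀ B : Set ℝ, MeasurableSet B → F (finitePart B) =
      volume ({u | ∃ x ∈ B, L g u (u + T) = ((u + x : ℝ) : WithTop ℝ)} ∩ Ico 0 1))
    (hfin : ∀ u, L g u (u + T) ≠ ⊤) {t : ℝ} (ht : t ∈ Ioo 0 T)
    (h1 : F (finitePart (Icc 0 t)) ≠ 1) (h2 : F (finitePart (Icc t T)) ≠ 1) :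
    (activeAt T (filledLocation L g T 0) t).Nonempty := by
  have hr := hL.isSliding_filledLocation_zero hT g
  have hval (u : ℝ) : L g u (u + T) =
      ((u + (filledLocation L g T 0 u - u) : ℝ) : WithTop ℝ) := by
    obtain ⟨y, hy⟩ := WithTop.ne_top_iff_exists.1 (hfin u)
    simp [filledLocation, ← hy]
  have hex (a b : ℝ) (hab : F (finitePart (Icc a b)) ≠ 1) :
      ∃ u, filledLocation L g T 0 u - u ∉ Icc a b := by
    by_contra! h
    refine hab ?_
    rw [hF _ measurableSet_Icc]
    have : {u | ∃ x ∈ Icc a b, L g u (u + T) = ((u + x : ℝ) : WithTop ℝ)} = univ :=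
      eq_univ_of_forall fun u => ⟨_, h u, hval u⟩
    rw [this]
    simp
  obtain ⟨u, hu⟩ := hex 0 t h1
  obtain ⟨v, hv⟩ := hex t T h2
  have hu' : u + t < filledLocation L g T 0 u := by
    by_contra! h
    exact hu ⟨by linarith [hr.self_le u], by linarith⟩
  have hv' : filledLocation L g T 0 v < v + t := by
    by_contra! h
    exact hv ⟨by linarith, by linarith [hr.le_add v]⟩
  obtain ⟨n, hn⟩ := exists_int_add_mem_Ioc u v
  obtain ⟨y, h3, h4, -⟩ := hr.exists_crossing ht hn.1 hu' (by
    rw [hr.apply_add_int]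
    linarith)
  exact ⟨y, h3.le, h4⟩

end IsIntrinsicLocation

theorem proposition3p1 {Ω : Type*} [MeasurableSpace Ω] (P : Measure Ω) [IsProbabilityMeasure P]
    (X : ℝ → Ω → ℝ) (H : PathClass) (hX : ∀ ω, (fun t => X t ω) ∈ H.carrier)
    (hcont : ∀ ω, Continuous fun t => X t ω) (herg : IsErgodicProcess P X)
    (L : H.carrier → ℝ → ℝ → WithTop ℝ) (hL : IsIntrinsicLocation H L)
    (T : ℝ) (hT0 : 0 < T) (hT1 : T ≤ 1) :
    (∃ f : ℝ → ℝ, IsCadlagDensity (locationLaw P X H hX L T) T f) ∧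
    ∀ f : ℝ → ℝ, IsCadlagDensity (locationLaw P X H hX L T) T f →
      (∀ t ∈ Ioo 0 T, ∃ n : ℕ, f t = n) ∧
      VariationConstraint T f ∧
      (0 < locationLaw P X H hX L T (finitePart (Icc 0 T)) →
        (¬ ∃ t ∈ Ioo 0 T, locationLaw P X H hX L T (finitePart (Icc 0 t)) = 1 ∨
          locationLaw P X H hX L T (finitePart (Icc t T)) = 1) →
        (∀ t ∈ Ioo 0 T, 1 ≤ f t) ∧
        (0 < locationLaw P X H hX L T {⊤} → VariationConstraint T fun t => f t - 1)) := by
  obtain ⟨g, -, hF⟩ := exists_path_locationLaw_eq hX hcont herg hL hT0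
  have hprob := isProbabilityMeasure_locationLaw (P := P) hX herg.1.1 hL hT0
  set F := locationLaw P X H hX L T
  have hr := hL.isSliding_filledLocation_zero hT0 g
  have hq := hL.isSliding_filledLocation_right hT0 g
  have hd := hL.isCadlagDensity_activeCount hT0 hF
  have hrq (x : ℝ) : positions T (filledLocation L g T 0) x =
      positions T (filledLocation L g T T) x := by
    rw [positions_filledLocation L g (fun h => lt_irrefl _ h.1),
      positions_filledLocation L g (fun h => lt_irrefl _ h.2)]
  have hr₀ {u : ℝ} (hu : L g u (u + T) = ⊤) : filledLocation L g T 0 u = u := by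
    simp [filledLocation, hu]
  have hq₀ {u : ℝ} (hu : L g u (u + T) = ⊤) : filledLocation L g T T u = u + T := by
    simp [filledLocation, hu]
  refine ⟨⟨_, hd⟩, fun f hf => ?_⟩
  have hfa : EqOn (activeCount T (filledLocation L g T 0)) f (Ioo 0 T) := hd.eqOn hf
  refine ⟨fun t ht => ⟨_, (hfa ht).symm⟩, ?_, fun hpos hno => ?_⟩
  · refine VariationConstraint.congr (f := fun t => activeCount T (filledLocation L g T 0) t - 0)
      (by simpa using hfa) ?_
    refine hr.variationConstraint_activeCount_sub fun s t hs hst ht => ?_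
    rw [sub_zero]
    exact hr.ncard_startingIn_le hs hst.le ht
  have hone : ∀ t ∈ Ioo 0 T, 1 ≤ activeCount T (filledLocation L g T 0) t := by
    intro t ht
    by_cases htop : ∃ u, L g u (u + T) = ⊤
    · obtain ⟨u₀, hu₀⟩ := htop
      rw [hF _ measurableSet_Icc] at hpos
      obtain ⟨u, ⟨x, -, hu⟩, -⟩ := nonempty_of_measure_ne_zero hpos.ne'
      refine hr.one_le_activeCount_of_forall_ne ht (c := filledLocation L g T 0 u - u)
        fun s hs hsc => hr.one_le_activeCount hs ?_
      exact hr.activeAt_nonempty_of_escape hq hrq (hr₀ hu₀) (hq₀ hu₀) hs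
        (by simp [filledLocation, hu]) hsc
    · push Not at htop
      refine hr.one_le_activeCount ht (hL.activeAt_nonempty_of_forall_ne_top hT0 hF htop ht ?_ ?_)
      · exact fun h => hno ⟨t, ht, Or.inl h⟩
      · exact fun h => hno ⟨t, ht, Or.inr h⟩
  refine ⟨fun t ht => hfa ht ▸ hone t ht, fun htop => ?_⟩
  -- The path `g` represents only the finite part of the law, so an infinite moment comes from total
  -- mass: otherwise the finite part would have probability 1.
  obtain ⟨u₀, hu₀⟩ : ∃ u, L g u (u + T) = ⊤ := by
    by_contra! h
    have h1 : F (finitePart univ) = 1 := by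
      rw [hF _ MeasurableSet.univ]
      have : {u | ∃ x ∈ univ, L g u (u + T) = ((u + x : ℝ) : WithTop ℝ)} = univ := by
        refine eq_univ_of_forall fun u => ?_
        obtain ⟨y, hy⟩ := WithTop.ne_top_iff_exists.1 (h u)
        exact ⟨y - u, mem_univ _, by rw [← hy, add_sub_cancel]⟩
      rw [this]
      simp
    have h2 : {(⊤ : WithTop ℝ)} ⊆ (finitePart univ)ᶜ := by
      rintro _ rfl ⟨x, -, hx⟩
      exact WithTop.coe_ne_top hx
    have h3 := (prob_compl_eq_zero_iff (measurableSet_finitePart MeasurableSet.univ)).2 h1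
    exact htop.ne' (measure_mono_null h2 h3)
  refine VariationConstraint.congr (f := fun t => activeCount T (filledLocation L g T 0) t - 1)
    (fun t ht => by simp only [hfa ht]) ?_
  exact hr.variationConstraint_activeCount_sub fun s t hs hst ht =>
    hr.ncard_startingIn_add_one_le hq hrq (hr₀ hu₀) (hq₀ hu₀) hs hst.le ht
      (hone s ⟨hs, hst.trans ht⟩)
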